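/- **Setting.** Let $\Omega\subset\mathbb R^n$ be bounded and open, $\epsilon\in(0,\infty]$, $T>0$, $0<a_*\le a^*$. Put $\Omega_{\mathcal I}=\{y\notin\Omega:\ |y-x|\le\epsilon\text{ for some }x\in\Omega\}$, $\tilde\Omega=\Omega\cup\Omega_{\mathcal I}$, $Q=\Omega\times(0,T)$, $\tilde Q=\tilde\Omega\times(0,T)$. Let $\beta$ be continuous on $\tilde\Omega$ with $0<\beta_*\le\beta(x)\le\beta^*<1$ for some constants $\beta_*,\beta^*$. Let $a=(a_{ij}(t,x,y))_{1\le i,j\le n}$ be symmetric with $a_{ij}\in C^1([0,T]\times\mathbb R^n\times\mathbb R^n)$ and $$a_*|\xi|^2\le\sum_{i,j}a_{ij}\xi_i\xi_j\le a^*|\xi|^2,\qquad \sum_{i,j}\partial_t a_{ij}\,\xi_i\xi_j\le a^*|\xi|^2$$ for $\xi\in\mathbb R^n$, $t\in[0,T]$ and $x,y\in\tilde\Omega$ with $|y-x|\le\epsilon$. Put $\alpha(x,y)=\frac{y-x}{|y-x|^{n/2+\beta(x)+1}}1_{\{|y-x|\le\epsilon\}}$, $\mathcal D^*v(x,y)=-(v(y)-v(x))\alpha(x,y)$,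 and $$B_t(v,w)=\int_{\tilde\Omega}\int_{\tilde\Omega}\mathcal D^*v\cdot\big(a(t,x,y)\,\mathcal D^*w\big)\,dy\,dx .$$ Let $\|v\|_{H^{\beta(\cdot)}(\tilde\Omega)}=\|v\|_{L^2(\tilde\Omega)}+\Big(\int_{\tilde\Omega}\int_{\tilde\Omega}\frac{(v(y)-v(x))^2}{|y-x|^{n+2\beta(x)}}dy\,dx\Big)^{1/2}$. A subscript $c$ denotes the constraint $v=0$ a.e. on $\Omega_{\mathcal I}$ (Dirichlet case), respectively $v\in L^1(\tilde\Omega)$ and $\int_{\tilde\Omega}v\,dx=0$ (Neumann case). Let $V_c$ be the set of $v\in L^2_c(\tilde\Omega)$ with $B_t(v,v)<\infty$ for $t\in[0,T]$. Let $u$ be a solution with zero source of the Dirichlet or of the Neumann volume-constrained problem for $\partial_tu+\mathcal D(a\cdot\mathcal D^*u)=0$, in the following sense: $u\in L^2(0,T;V_c)$, the weak derivative $\partial_tu$ lies in $L^2(0,T;L^2(\Omega))$, and for all $\phi\in V_c$ $$\int_\Omega\partial_tu\,\phi\,dx+B_t(u,\phi)=0\quad\text{for a.e. }t\in(0,T).$$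 Assume also $u\in C((0,T];H^{\beta(\cdot)}_c(\tilde\Omega))$. **Theorem.** (i) For every $t_0\in(0,T)$ there are $\theta\in(0,1)$ and $C>0$, depending only on $t_0,a_*,a^*,T,\Omega,\Omega_{\mathcal I}$, such that $$\|u(\cdot,t_0)\|_{L^2(\Omega)}\le C\,\|u\|_{L^2(\tilde Q)}^{1-\theta}\,\|u(\cdot,T)\|_{H^{\beta(\cdot)}(\tilde\Omega)}^{\theta}.$$ (ii) If in addition $u(\cdot,0)\in L^2_c(\tilde\Omega)$ is the initial value of $u$ (attained in $L^2(\Omega)$ as $t\downarrow0$), then $$\|u\|_{L^2(Q)}=O\Big(\Big(\log\frac1{\|u(\cdot,T)\|_{H^{\beta(\cdot)}(\tilde\Omega)}}\Big)^{-1/2}\Big)\quad\text{as }\|u(\cdot,T)\|_{H^{\beta(\cdot)}(\tilde\Omega)}\to0,$$ with the following uniformity: there is $C>0$ depending only on $a_*,a^*,T,\Omega,\Omega_{\mathcal I}$ such that, whenever $0<\|u(\cdot,T)\|_{H^{\beta(\cdot)}(\tilde\Omega)}<1$, $$\|u\|_{L^2(Q)}\le C\big(1+\|u(\cdot,0)\|_{L^2(\tilde\Omega)}\big)\Big(\log\frac1{\|u(\cdot,T)\|_{H^{\beta(\cdot)}(\tilde\Omega)}}\Big)^{-1/2}.$$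 -/

import Mathlib

open MeasureTheory Set Filter Topology
open scoped ENNReal ContDiff Matrix

namespace NonlocalDiffusion

noncomputable section

/-- The space `ℝⁿ` with its Euclidean norm. -/
abbrev Rn (n : ℕ) : Type := EuclideanSpace ℝ (Fin n)

/-- The two types of volume constraint. -/
inductive Constraint where
  | dirichlet
  | neumann

variable {n : ℕ}

/-- `α(x,y) = (y - x) / |y - x|^(n/2 + β(x) + 1)` for `|y - x| ≤ ε`, and `0` otherwise.
The horizon `ε` may be `∞`. -/
def alpha (ε : ℝ≥0∞) (β : Rn n → ℝ) (x y : Rn n) : Fin n → ℝ :=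
  open Classical in
  if edist y x ≤ ε then fun i => (y i - x i) / ‖y - x‖ ^ ((n : ℝ) / 2 + β x + 1) else 0

/-- The interaction domain `Ω_I`: the points outside `Ω` at distance at most `ε` from some point
of `Ω`, that is, the points `y ∉ Ω` with `α(x,y) ≠ 0` for some `x ∈ Ω`
(see `mem_interactionDomain_iff`). -/
def interactionDomain (Ω : Set (Rn n)) (ε : ℝ≥0∞) : Set (Rn n) :=
  {y | y ∉ Ω ∧ ∃ x ∈ Ω, edist y x ≤ ε}

theorem mem_interactionDomain_iff (Ω : Set (Rn n)) (ε : ℝ≥0∞) (β : Rn n → ℝ) (y : Rn n) :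
    y ∈ interactionDomain Ω ε ↔ y ∉ Ω ∧ ∃ x ∈ Ω, alpha ε β x y ≠ 0 := by
  constructor
  · rintro ⟨hy, x, hx, hxy⟩
    refine ⟨hy, x, hx, fun h0 => hy ?_⟩
    have hyx : y = x := by
      by_contra hne
      have hpos : 0 < ‖y - x‖ := norm_pos_iff.2 (sub_ne_zero.2 hne)
      apply hne
      ext i
      have h1 := congrFun h0 i
      rw [alpha, if_pos hxy] at h1
      have h2 := (div_eq_zero_iff.1 h1).resolve_right (Real.rpow_pos_of_pos hpos _).ne'
      linarith
    exact hyx ▸ hx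
  · rintro ⟨hy, x, hx, hne⟩
    refine ⟨hy, x, hx, ?_⟩
    by_contra hlt
    exact hne (by rw [alpha, if_neg hlt])

/-- `Ω̃ = Ω ∪ Ω_I`. -/
def tildeDomain (Ω : Set (Rn n)) (ε : ℝ≥0∞) : Set (Rn n) :=
  Ω ∪ interactionDomain Ω ε

/-- `L²(Ω̃)`. -/
abbrev L2tilde (Ω : Set (Rn n)) (ε : ℝ≥0∞) : Type :=
  Lp ℝ 2 (volume.restrict (tildeDomain Ω ε))

/-- `L²(Ω)`; as `Ω ⊆ Ω̃`, the measure is Lebesgue measure on `Ω`. -/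
abbrev L2dom (Ω : Set (Rn n)) (ε : ℝ≥0∞) : Type :=
  Lp ℝ 2 ((volume.restrict (tildeDomain Ω ε)).restrict Ω)

/-- The restriction operator `L²(Ω̃) → L²(Ω)`. -/
abbrev resDom (Ω : Set (Rn n)) (ε : ℝ≥0∞) : L2tilde Ω ε →L[ℝ] L2dom Ω ε :=
  LpToLpRestrictCLM (Rn n) ℝ ℝ (volume.restrict (tildeDomain Ω ε)) 2 Ω

/-- The constraint `E_c(v) = 0`, where `E_c(v) = ∫_{Ω_I} v²` in the Dirichlet case and
`E_c(v) = (∫_{Ω̃} v)²` in the Neumann case. Integrability in the Neumann case is automatic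
when `ε < ∞`. -/
def ConstraintZero (bc : Constraint) (Ω : Set (Rn n)) (ε : ℝ≥0∞) (v : L2tilde Ω ε) : Prop :=
  match bc with
  | .dirichlet => ∫ x in interactionDomain Ω ε, (v x) ^ 2 = 0
  | .neumann => Integrable v (volume.restrict (tildeDomain Ω ε)) ∧
      (∫ x in tildeDomain Ω ε, v x) ^ 2 = 0

/-- The squared seminorm of the variable-order Sobolev space `H^{β(·)}(Ω̃)`. -/
def sobolevSemiSq (Ω : Set (Rn n)) (ε : ℝ≥0∞) (β : Rn n → ℝ) (v : L2tilde Ω ε) : ℝ≥0∞ :=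
  ∫⁻ x in tildeDomain Ω ε, ∫⁻ y in tildeDomain Ω ε,
    ENNReal.ofReal ((v y - v x) ^ 2 / ‖y - x‖ ^ ((n : ℝ) + 2 * β x))

/-- The norm `‖v‖_{L²(Ω̃)} + |v|_{H^{β(·)}(Ω̃)}`, with value `∞` outside `H^{β(·)}(Ω̃)`. -/
def sobolevENorm (Ω : Set (Rn n)) (ε : ℝ≥0∞) (β : Rn n → ℝ) (v : L2tilde Ω ε) : ℝ≥0∞ :=
  ‖v‖ₑ + (sobolevSemiSq Ω ε β v) ^ (1 / 2 : ℝ)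

/-- The norm of `H^{β(·)}(Ω̃)` as a real number. -/
def sobolevNorm (Ω : Set (Rn n)) (ε : ℝ≥0∞) (β : Rn n → ℝ) (v : L2tilde Ω ε) : ℝ :=
  (sobolevENorm Ω ε β v).toReal

/-- Membership in `H_c^{β(·)}(Ω̃)`. -/
def MemHc (bc : Constraint) (Ω : Set (Rn n)) (ε : ℝ≥0∞) (β : Rn n → ℝ) (v : L2tilde Ω ε) : Prop :=
  sobolevENorm Ω ε β v < ⊤ ∧ ConstraintZero bc Ω ε v

/-- The adjoint nonlocal divergence `D*(v)(x,y) = -(v(y) - v(x)) α(x,y)`. -/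
def Dstar (ε : ℝ≥0∞) (β : Rn n → ℝ) (v : Rn n → ℝ) (x y : Rn n) : Fin n → ℝ :=
  (-(v y - v x)) • alpha ε β x y

/-- The bilinear form `∫_{Ω̃} ∫_{Ω̃} D*(v) · (a(t,x,y) · D*(w)) dy dx`. -/
def energyForm (Ω : Set (Rn n)) (ε : ℝ≥0∞) (β : Rn n → ℝ)
    (a : ℝ → Rn n → Rn n → Matrix (Fin n) (Fin n) ℝ) (t : ℝ) (v w : L2tilde Ω ε) : ℝ :=
  ∫ x in tildeDomain Ω ε, ∫ y in tildeDomain Ω ε,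
    Dstar ε β v x y ⬝ᵥ (a t x y *ᵥ Dstar ε β w x y)

/-- The squared nonlocal energy norm `|||v|||²` at time `t`. -/
def energySq (Ω : Set (Rn n)) (ε : ℝ≥0∞) (β : Rn n → ℝ)
    (a : ℝ → Rn n → Rn n → Matrix (Fin n) (Fin n) ℝ) (t : ℝ) (v : L2tilde Ω ε) : ℝ≥0∞ :=
  (1 / 2) * ∫⁻ x in tildeDomain Ω ε, ∫⁻ y in tildeDomain Ω ε,
    ENNReal.ofReal (Dstar ε β v x y ⬝ᵥ (a t x y *ᵥ Dstar ε β v x y))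

/-- Membership in the constrained energy space `V_c(Ω̃)`. -/
def MemVc (bc : Constraint) (Ω : Set (Rn n)) (ε : ℝ≥0∞) (β : Rn n → ℝ)
    (a : ℝ → Rn n → Rn n → Matrix (Fin n) (Fin n) ℝ) (T : ℝ) (v : L2tilde Ω ε) : Prop :=
  (∀ t ∈ Icc 0 T, energySq Ω ε β a t v < ⊤) ∧ ConstraintZero bc Ω ε v

/-- The order `β` is continuous on `Ω̃` with `0 < β_* ≤ β ≤ β^* < 1`. -/
def IsOrder (Ω : Set (Rn n)) (ε : ℝ≥0∞) (β : Rn n → ℝ) : Prop :=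
  ContinuousOn β (tildeDomain Ω ε) ∧
    ∃ βlo βhi : ℝ, 0 < βlo ∧ βhi < 1 ∧ ∀ x ∈ tildeDomain Ω ε, βlo ≤ β x ∧ β x ≤ βhi

/-- The assumptions on the diffusion tensor `a`, with ellipticity constants `alo` and `ahi`. -/
structure IsTensor (Ω : Set (Rn n)) (ε : ℝ≥0∞) (T alo ahi : ℝ)
    (a : ℝ → Rn n → Rn n → Matrix (Fin n) (Fin n) ℝ) : Prop where
  contDiffOn : ∀ i j, ContDiffOn ℝ 1
    (fun p : ℝ × Rn n × Rn n => a p.1 p.2.1 p.2.2 i j) (Icc 0 T ×ˢ univ)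
  symm : ∀ t ∈ Icc 0 T, ∀ x y i j, a t x y i j = a t x y j i
  lower : ∀ t ∈ Icc 0 T, ∀ x ∈ tildeDomain Ω ε, ∀ y ∈ tildeDomain Ω ε, edist y x ≤ ε →
    ∀ ξ : Fin n → ℝ, alo * ∑ i, ξ i ^ 2 ≤ ∑ i, ∑ j, a t x y i j * ξ i * ξ j
  upper : ∀ t ∈ Icc 0 T, ∀ x ∈ tildeDomain Ω ε, ∀ y ∈ tildeDomain Ω ε, edist y x ≤ ε →
    ∀ ξ : Fin n → ℝ, ∑ i, ∑ j, a t x y i j * ξ i * ξ j ≤ ahi * ∑ i, ξ i ^ 2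
  deriv_upper : ∀ t ∈ Icc 0 T, ∀ x ∈ tildeDomain Ω ε, ∀ y ∈ tildeDomain Ω ε, edist y x ≤ ε →
    ∀ ξ : Fin n → ℝ,
      ∑ i, ∑ j, derivWithin (fun s => a s x y i j) (Icc 0 T) t * ξ i * ξ j ≤ ahi * ∑ i, ξ i ^ 2

/-- `w'` is the weak derivative of `w` on `(0,T)`. -/
def IsWeakTimeDeriv {X : Type*} [NormedAddCommGroup X] [NormedSpace ℝ X]
    (T : ℝ) (w w' : ℝ → X) : Prop :=
  ∀ φ : ℝ → ℝ, ContDiff ℝ ∞ φ → HasCompactSupport φ → tsupport φ ⊆ Ioo 0 T →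
    ∫ t in Ioo 0 T, deriv φ t • w t = -∫ t in Ioo 0 T, φ t • w' t

/-- The norm of `L²(0,T;X)`. -/
def timeL2Norm {X : Type*} [NormedAddCommGroup X] (T : ℝ) (w : ℝ → X) : ℝ :=
  Real.sqrt (∫ t in Ioo 0 T, ‖w t‖ ^ 2)

/-- `u` solves, in the parabolic variational formulation on `(0,T)` and with zero source, the
nonlocal diffusion equation with the volume constraint `bc`, and `∂ₜu ∈ L²(0,T;L²(Ω))`:
`u ∈ L²(0,T;V_c(Ω̃))`, and for all `φ ∈ V_c(Ω̃)`,
`∫_Ω ∂ₜu φ + ∫_{Ω̃} ∫_{Ω̃} D*(u) · (a · D*(φ)) = 0` for almost every `t`. -/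
structure IsSolution (bc : Constraint) (Ω : Set (Rn n)) (ε : ℝ≥0∞) (β : Rn n → ℝ)
    (a : ℝ → Rn n → Rn n → Matrix (Fin n) (Fin n) ℝ) (T : ℝ) (u : ℝ → L2tilde Ω ε) : Prop where
  memLp : MemLp u 2 (volume.restrict (Ioo 0 T))
  memVc : ∀ᵐ t ∂(volume.restrict (Ioo 0 T)), MemVc bc Ω ε β a T (u t)
  energy_finite : ∫⁻ t in Ioo 0 T, energySq Ω ε β a t (u t) < ⊤
  equation : ∃ u' : ℝ → L2dom Ω ε, MemLp u' 2 (volume.restrict (Ioo 0 T)) ∧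
    IsWeakTimeDeriv T (fun t => resDom Ω ε (u t)) u' ∧
    ∀ φ : L2tilde Ω ε, MemVc bc Ω ε β a T φ →
      ∀ᵐ t ∂(volume.restrict (Ioo 0 T)),
        inner ℝ (u' t) (resDom Ω ε φ) + energyForm Ω ε β a t (u t) φ = 0

/-- `u` is continuous on `(0,T]` with values in `H_c^{β(·)}(Ω̃)`. -/
def ContinuousInHc (bc : Constraint) (Ω : Set (Rn n)) (ε : ℝ≥0∞) (β : Rn n → ℝ)
    (T : ℝ) (u : ℝ → L2tilde Ω ε) : Prop :=
  ∀ t ∈ Ioc 0 T, MemHc bc Ω ε β (u t) ∧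
    Tendsto (fun s => sobolevENorm Ω ε β (u s - u t)) (𝓝[Ioc 0 T] t) (𝓝 0)

/-- The initial value `u(0) ∈ L²_c(Ω̃)` is attained in `L²(Ω)`. -/
def HasInitialValue (bc : Constraint) (Ω : Set (Rn n)) (ε : ℝ≥0∞) (u : ℝ → L2tilde Ω ε) : Prop :=
  ConstraintZero bc Ω ε (u 0) ∧
    Tendsto (fun t => resDom Ω ε (u t)) (𝓝[>] 0) (𝓝 (resDom Ω ε (u 0)))

end

end NonlocalDiffusion

open NonlocalDiffusion

/-! The kernel of `B_t` is `|y - x|^(-n - 2 β(x))` times the value of `a(t, x, y)` on the unit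
vector from `x` to `y`. That value is at least `a_*` and has time derivative at most `a^*`, hence
it grows at relative rate at most `κ = a^* / a_*`, whatever `β` is. Therefore the frequency
`B_t(u, u) / ‖u‖²` multiplied by `e^(-κ t)` is nonincreasing along solutions, which means that
`log ‖u‖²` is a convex function of `e^(κ t)`. Convexity between a time `t₁ > 0` and `T`, with
`‖u(t₁)‖` controlled by the norm of `u` in space-time because `‖u‖` decreases, is the
interpolation inequality (i). Convexity between `0` and `T` gives `‖u(t)‖ ≤ K ‖u(T)‖^(c t)` with
`K = 1 + ‖u(0)‖`, and integrating its square in `t` gives (ii).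
-/

namespace NonlocalDiffusion

theorem timeL2Norm_nonneg {X : Type*} [NormedAddCommGroup X] (T : ℝ) (w : ℝ → X) :
    0 ≤ timeL2Norm T w :=
  Real.sqrt_nonneg _

theorem timeL2Norm_le_of_norm_sq_le_exp {X : Type*} [NormedAddCommGroup X] {T : ℝ} {w : ℝ → X}
    {K l : ℝ} (hK : 0 ≤ K) (hl : 0 < l)
    (hw : ∀ t ∈ Ioo 0 T, ‖w t‖ ^ 2 ≤ K ^ 2 * Real.exp (-l * t)) :
    timeL2Norm T w ≤ K * l ^ (-(1 / 2) : ℝ) := by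
  have hi : IntegrableOn (fun t => K ^ 2 * Real.exp (-l * t)) (Ioi 0) :=
    (integrableOn_exp_mul_Ioi (neg_neg_of_pos hl) 0).const_mul _
  have hsub : Ioo 0 T ⊆ Ioi 0 := Ioo_subset_Ioi_self
  have hintegral : ∫ t in Ioo 0 T, ‖w t‖ ^ 2 ≤ K ^ 2 / l :=
    calc ∫ t in Ioo 0 T, ‖w t‖ ^ 2 ≤ ∫ t in Ioo 0 T, K ^ 2 * Real.exp (-l * t) :=
          integral_mono_of_nonneg (Eventually.of_forall fun _ => sq_nonneg _)
            (hi.mono_set hsub) (ae_restrict_of_forall_mem measurableSet_Ioo hw)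
      _ ≤ ∫ t in Ioi 0, K ^ 2 * Real.exp (-l * t) :=
          setIntegral_mono_set hi (Eventually.of_forall fun _ => by positivity)
            hsub.eventuallyLE
      _ = K ^ 2 / l := by
          rw [integral_const_mul, integral_exp_mul_Ioi (neg_neg_of_pos hl)]
          simp [div_eq_mul_inv]
  refine Real.sqrt_le_iff.2 ⟨by positivity, hintegral.trans (le_of_eq ?_)⟩
  rw [mul_pow, ← Real.rpow_mul_natCast hl.le]
  norm_num [Real.rpow_neg_one, div_eq_mul_inv]

section EnergyFlow

variable {X : Type*} [NormedAddCommGroup X] [InnerProductSpace ℝ X] {T κ : ℝ} {U : ℝ → X}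
  {b : ℝ → ℝ → ℝ}

/-- A Hilbert-space gradient flow `U' = -A_t U` on `(0,T)` for a moving nonnegative quadratic form,
seen only through the scalars `b r s = ⟨A_r U(r), U(s)⟩`. The last field says that the form grows
at relative rate at most `κ`: polarization bounds `2 b r t - b r r` by `⟨A_r U(t), U(t)⟩`. -/
structure IsEnergyFlow (T κ : ℝ) (U : ℝ → X) (b : ℝ → ℝ → ℝ) : Prop where
  continuousOn : ContinuousOn (Function.uncurry b) (Ioo 0 T ×ˢ Ioo 0 T)
  hasDerivAt_inner : ∀ s ∈ Ioo 0 T, ∀ r ∈ Ioo 0 T,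
    HasDerivAt (fun r => inner ℝ (U r) (U s)) (-(b r s)) r
  nonneg : ∀ t ∈ Ioo 0 T, 0 ≤ b t t
  two_mul_sub_le : ∀ t ∈ Ioo 0 T, ∀ r ∈ Ioo 0 T, t ≤ r →
    2 * b r t - b r r ≤ (1 + κ * (r - t)) * b t t

namespace IsEnergyFlow

theorem continuousAt_diag (h : IsEnergyFlow T κ U b) {t : ℝ} (ht : t ∈ Ioo 0 T) :
    ContinuousAt (Function.uncurry b) (t, t) :=
  h.continuousOn.continuousAt ((isOpen_Ioo.prod isOpen_Ioo).mem_nhds ⟨ht, ht⟩)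

theorem isLittleO_norm_sub_sq (h : IsEnergyFlow T κ U b) {t : ℝ} (ht : t ∈ Ioo 0 T) :
    (fun r => ‖U r - U t‖ ^ 2) =o[𝓝 t] fun r => r - t := by
  refine Asymptotics.isLittleO_iff.2 fun c hc => ?_
  have hnear : ∀ᶠ p : ℝ × ℝ in 𝓝 (t, t), dist (b p.1 p.2) (b t t) < c / 2 :=
    Metric.tendsto_nhds.1 (h.continuousAt_diag ht) _ (half_pos hc)
  rw [nhds_prod_eq] at hnear
  obtain ⟨s, hs, hsb⟩ :=
    (eventually_prod_self_iff (r := fun x y => dist (b x y) (b t t) < c / 2)).1 hnear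
  obtain ⟨d, hd, hds⟩ := Metric.mem_nhds_iff.1 (inter_mem hs (isOpen_Ioo.mem_nhds ht))
  filter_upwards [Metric.ball_mem_nhds t hd] with r hr
  have hderiv : ∀ x ∈ Metric.ball t d, HasDerivWithinAt
      (fun x => inner ℝ (U x) (U r) - inner ℝ (U x) (U t)) (-(b x r) - -(b x t))
      (Metric.ball t d) x := fun x hx =>
    ((h.hasDerivAt_inner r (hds hr).2 x (hds hx).2).sub
      (h.hasDerivAt_inner t ht x (hds hx).2)).hasDerivWithinAt
  have hbound : ∀ x ∈ Metric.ball t d, ‖-(b x r) - -(b x t)‖ ≤ c := fun x hx => by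
    have hxr := hsb x (hds hx).1 r (hds hr).1
    have hxt := hsb x (hds hx).1 t (mem_of_mem_nhds hs)
    rw [Real.norm_eq_abs, neg_sub_neg, ← Real.dist_eq, dist_comm]
    exact (dist_triangle_right _ _ (b t t)).trans (by simpa using (add_lt_add hxr hxt).le)
  have key := (convex_ball t d).norm_image_sub_le_of_norm_hasDerivWithin_le hderiv hbound
    (Metric.mem_ball_self hd) hr
  rw [← inner_sub_right, ← inner_sub_right, ← inner_sub_left, real_inner_self_eq_norm_sq] at key
  exact key

theorem hasDerivAt_norm_sq (h : IsEnergyFlow T κ U b) {t : ℝ} (ht : t ∈ Ioo 0 T) :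
    HasDerivAt (fun r => ‖U r‖ ^ 2) (-2 * b t t) t := by
  have hsmall : HasDerivAt (fun r => ‖U r - U t‖ ^ 2) 0 t := by
    rw [hasDerivAt_iff_isLittleO]
    simpa using h.isLittleO_norm_sub_sq ht
  have hpolar : (fun r => ‖U r‖ ^ 2) =
      fun r => 2 * inner ℝ (U r) (U t) - ‖U t‖ ^ 2 + ‖U r - U t‖ ^ 2 := by
    ext r
    rw [norm_sub_sq_real]
    ring
  rw [hpolar]
  exact ((((h.hasDerivAt_inner t ht t ht).const_mul 2).sub_const _).fun_add hsmall).congr_deriv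
    (by ring)

theorem antitoneOn_norm_sq (h : IsEnergyFlow T κ U b) :
    AntitoneOn (fun t => ‖U t‖ ^ 2) (Ioo 0 T) := by
  refine antitoneOn_of_hasDerivWithinAt_nonpos (convex_Ioo 0 T)
    (fun t ht => (h.hasDerivAt_norm_sq ht).continuousAt.continuousWithinAt)
    (fun t ht => (h.hasDerivAt_norm_sq (interior_subset ht)).hasDerivWithinAt) fun t ht => ?_
  linarith [h.nonneg t (interior_subset ht)]

theorem hasDerivAt_norm_sub_sq (h : IsEnergyFlow T κ U b) {t r : ℝ} (ht : t ∈ Ioo 0 T)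
    (hr : r ∈ Ioo 0 T) :
    HasDerivAt (fun r => ‖U r - U t‖ ^ 2) (2 * (b r t - b r r)) r := by
  simp only [norm_sub_sq_real]
  exact (((h.hasDerivAt_norm_sq hr).sub
    ((h.hasDerivAt_inner t ht r hr).const_mul 2)).add_const _).congr_deriv (by ring)

theorem norm_sub_sq_le (h : IsEnergyFlow T κ U b) {t r ρ : ℝ} (ht : t ∈ Ioo 0 T)
    (hr : r ∈ Ioo 0 T) (htr : t ≤ r)
    (hρ : ∀ x ∈ Ioo t r, b t t + ρ * (x - t) ≤ b x x) :
    ‖U r - U t‖ ^ 2 ≤ (κ * b t t - ρ) / 2 * (r - t) ^ 2 := by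
  have hsub : Icc t r ⊆ Ioo 0 T := Icc_subset_Ioo ht.1 hr.2
  have hderiv : ∀ x ∈ Icc t r, HasDerivAt
      (fun x => ‖U x - U t‖ ^ 2 - (κ * b t t - ρ) / 2 * (x - t) ^ 2)
      (2 * (b x t - b x x) - (κ * b t t - ρ) * (x - t)) x := fun x hx =>
    ((h.hasDerivAt_norm_sub_sq ht (hsub hx)).sub
      ((((hasDerivAt_id' x).sub_const t).fun_pow 2).const_mul _)).congr_deriv (by ring)
  have hanti := antitoneOn_of_hasDerivWithinAt_nonpos (convex_Icc t r)
    (fun x hx => (hderiv x hx).continuousAt.continuousWithinAt)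
    (fun x hx => (hderiv x (interior_subset hx)).hasDerivWithinAt) fun x hx => by
      rw [interior_Icc] at hx
      have hgrowth := h.two_mul_sub_le t ht x (hsub (Ioo_subset_Icc_self hx)) hx.1.le
      linarith [hρ x hx]
  simpa using hanti (left_mem_Icc.2 htr) (right_mem_Icc.2 htr) htr

/-- The energy need not be differentiable. The idea replacing its derivative: if it grew at rate
`ρ`, then `norm_sub_sq_le` would make `U` so slow that Cauchy-Schwarz forbids the decay rate
`-b t t` of `⟨U, U t⟩`. -/
theorem frequently_slope_energy_lt (h : IsEnergyFlow T κ U b) {t m ρ : ℝ} (ht : t ∈ Ioo 0 T)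
    (hm : 0 < m) (hUm : ‖U t‖ ^ 2 ≤ m) (hρ : κ * b t t - 2 * b t t ^ 2 / m < ρ) :
    ∃ᶠ r in 𝓝[>] t, slope (fun r => b r r) t r < ρ := by
  refine fun hslope => hρ.not_ge ?_
  obtain ⟨d, htd, hd⟩ := (mem_nhdsGT_iff_exists_Ioo_subset' ht.2).1 hslope
  have henergy : ∀ x ∈ Ioo t d, b t t + ρ * (x - t) ≤ b x x := fun x hx => by
    have hx' : ρ ≤ slope (fun r => b r r) t x := not_lt.1 (hd hx)
    rw [slope_def_field, le_div_iff₀ (sub_pos.2 hx.1)] at hx'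
    linarith
  have hspeed : ∀ᶠ r in 𝓝[>] t,
      slope (fun r => inner ℝ (U r) (U t)) t r ^ 2 ≤ m * ((κ * b t t - ρ) / 2) := by
    filter_upwards [Ioo_mem_nhdsGT htd, Ioo_mem_nhdsGT ht.2] with r hrd hrT
    have hdist := h.norm_sub_sq_le ht ⟨ht.1.trans hrT.1, hrT.2⟩ hrT.1.le fun x hx =>
      henergy x ⟨hx.1, hx.2.trans hrd.2⟩
    have hpos : 0 < r - t := sub_pos.2 hrT.1
    rw [slope_def_field, div_pow, div_le_iff₀ (pow_pos hpos 2), ← inner_sub_left]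
    calc inner ℝ (U r - U t) (U t) ^ 2 ≤ (‖U r - U t‖ * ‖U t‖) ^ 2 :=
          sq_le_sq.2 ((abs_real_inner_le_norm _ _).trans (le_abs_self _))
      _ = ‖U t‖ ^ 2 * ‖U r - U t‖ ^ 2 := by ring
      _ ≤ m * ((κ * b t t - ρ) / 2 * (r - t) ^ 2) := by gcongr
      _ = m * ((κ * b t t - ρ) / 2) * (r - t) ^ 2 := by ring
  have hlim := ((hasDerivAt_iff_tendsto_slope.1 (h.hasDerivAt_inner t ht t ht)).mono_left
    (nhdsWithin_mono t fun r (hr : r ∈ Ioi t) => ne_of_gt hr)).pow 2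
  have hle := le_of_tendsto hlim hspeed
  rw [le_sub_comm, div_le_iff₀ hm]
  linarith

end IsEnergyFlow

/-- The frequency of a flow at time `t`, the quotient of its energy by its squared norm; the
parameter `η > 0` keeps the denominator away from `0`. -/
noncomputable def frequency (U : ℝ → X) (b : ℝ → ℝ → ℝ) (η t : ℝ) : ℝ :=
  b t t / (‖U t‖ ^ 2 + η)

namespace IsEnergyFlow

theorem continuousOn_energy (h : IsEnergyFlow T κ U b) :
    ContinuousOn (fun t => b t t) (Ioo 0 T) :=
  h.continuousOn.comp (continuous_id.prodMk continuous_id).continuousOn fun _ ht => ⟨ht, ht⟩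

theorem energy_le_exp_mul_frequency (h : IsEnergyFlow T κ U b) {η δ t₀ t : ℝ} (hη : 0 < η)
    (hδ : 0 < δ) (ht₀ : t₀ ∈ Ioo 0 T) (ht : t ∈ Ioo 0 T) (htt : t₀ ≤ t) :
    b t t ≤ (frequency U b η t₀ + δ) * Real.exp ((κ + δ) * (t - t₀)) * (‖U t‖ ^ 2 + η) := by
  have hsub : Icc t₀ t ⊆ Ioo 0 T := Icc_subset_Ioo ht₀.1 ht.2
  have hm : ∀ x, 0 < ‖U x‖ ^ 2 + η := fun x => by positivity
  have hN : 0 < frequency U b η t₀ + δ :=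
    add_pos_of_nonneg_of_pos (div_nonneg (h.nonneg t₀ ht₀) (hm t₀).le) hδ
  set N := frequency U b η t₀ + δ
  have hbarrier : ∀ x ∈ Icc t₀ t, HasDerivAt
      (fun x => N * Real.exp ((κ + δ) * (x - t₀)) * (‖U x‖ ^ 2 + η))
      ((κ + δ) * (N * Real.exp ((κ + δ) * (x - t₀)) * (‖U x‖ ^ 2 + η)) -
        2 * (N * Real.exp ((κ + δ) * (x - t₀))) * b x x) x := fun x hx =>
    ((((((hasDerivAt_id' x).sub_const t₀).const_mul (κ + δ)).exp.const_mul N).fun_mul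
      ((h.hasDerivAt_norm_sq (hsub hx)).add_const η))).congr_deriv (by ring)
  refine image_le_of_liminf_slope_right_lt_deriv_boundary'
    (f' := fun x => κ * b x x - 2 * b x x ^ 2 / (‖U x‖ ^ 2 + η))
    (h.continuousOn_energy.mono hsub)
    (fun x hx ρ hρ => h.frequently_slope_energy_lt (hsub (Ico_subset_Icc_self hx)) (hm x)
      (le_add_of_nonneg_right hη.le) hρ) ?_
    (fun x hx => (hbarrier x hx).continuousAt.continuousWithinAt)
    (fun x hx => (hbarrier x (Ico_subset_Icc_self hx)).hasDerivWithinAt) (fun x _ heq => ?_)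
    (right_mem_Icc.2 htt)
  · have hinit : b t₀ t₀ = frequency U b η t₀ * (‖U t₀‖ ^ 2 + η) :=
      (div_mul_cancel₀ _ (hm t₀).ne').symm
    simp only [sub_self, mul_zero, Real.exp_zero, mul_one]
    rw [hinit]
    exact mul_le_mul_of_nonneg_right (le_add_of_nonneg_right hδ.le) (hm t₀).le
  · have hpos : 0 < b x x := heq ▸ mul_pos (mul_pos hN (Real.exp_pos _)) (hm x)
    have hfreq : b x x ^ 2 / (‖U x‖ ^ 2 + η) = N * Real.exp ((κ + δ) * (x - t₀)) * b x x := by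
      rw [sq, div_eq_iff (hm x).ne', mul_right_comm, ← heq]
    rw [← heq, mul_div_assoc, hfreq]
    linarith [mul_pos hδ hpos]

theorem antitoneOn_exp_mul_frequency (h : IsEnergyFlow T κ U b) {η : ℝ} (hη : 0 < η) :
    AntitoneOn (fun t => Real.exp (-(κ * t)) * frequency U b η t) (Ioo 0 T) := by
  intro t₀ ht₀ t ht htt
  have hlim : Tendsto (fun δ => (frequency U b η t₀ + δ) * Real.exp ((κ + δ) * (t - t₀)))
      (𝓝[>] 0) (𝓝 (frequency U b η t₀ * Real.exp (κ * (t - t₀)))) := by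
    refine tendsto_nhdsWithin_of_tendsto_nhds ?_
    exact Continuous.tendsto' (by fun_prop) _ _ (by simp)
  have hle : frequency U b η t ≤ frequency U b η t₀ * Real.exp (κ * (t - t₀)) := by
    refine ge_of_tendsto hlim (eventually_mem_nhdsWithin.mono fun δ hδ => ?_)
    rw [frequency, div_le_iff₀ (by positivity)]
    exact h.energy_le_exp_mul_frequency hη hδ ht₀ ht htt
  calc Real.exp (-(κ * t)) * frequency U b η t
      ≤ Real.exp (-(κ * t)) * (frequency U b η t₀ * Real.exp (κ * (t - t₀))) := by gcongr
    _ = Real.exp (-(κ * t₀)) * frequency U b η t₀ := by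
        rw [mul_left_comm, ← Real.exp_add, mul_comm]
        ring_nf

theorem hasDerivAt_log_norm_sq_add (h : IsEnergyFlow T κ U b) (hκ : 0 < κ) {η s : ℝ}
    (hη : 0 < η) (hs : 0 < s) (ht : Real.log s / κ ∈ Ioo 0 T) :
    HasDerivAt (fun s => Real.log (‖U (Real.log s / κ)‖ ^ 2 + η))
      (-(2 / κ) * (Real.exp (-(κ * (Real.log s / κ))) * frequency U b η (Real.log s / κ))) s := by
  have hlog : HasDerivAt (fun s => Real.log s / κ) (s⁻¹ / κ) s :=
    (Real.hasDerivAt_log hs.ne').div_const κ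
  have hpos : 0 < ‖U (Real.log s / κ)‖ ^ 2 + η := by positivity
  have hnorm : HasDerivAt (fun s => ‖U (Real.log s / κ)‖ ^ 2)
      (-2 * b (Real.log s / κ) (Real.log s / κ) * (s⁻¹ / κ)) s :=
    HasDerivAt.comp (h₂ := fun t => ‖U t‖ ^ 2) s (h.hasDerivAt_norm_sq ht) hlog
  refine ((hnorm.add_const η).log hpos.ne').congr_deriv ?_
  rw [mul_div_cancel₀ _ hκ.ne', Real.exp_neg, Real.exp_log hs, frequency]
  field_simp

theorem convexOn_log_norm_sq_add (h : IsEnergyFlow T κ U b) (hκ : 0 < κ) {η t₁ : ℝ}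
    (hη : 0 < η) (ht₁ : 0 ≤ t₁) (hU : ContinuousOn (fun t => ‖U t‖ ^ 2) (Icc t₁ T)) :
    ConvexOn ℝ (Icc (Real.exp (κ * t₁)) (Real.exp (κ * T)))
      (fun s => Real.log (‖U (Real.log s / κ)‖ ^ 2 + η)) := by
  have hpos : ∀ s ∈ Icc (Real.exp (κ * t₁)) (Real.exp (κ * T)), 0 < s :=
    fun s hs => (Real.exp_pos _).trans_le hs.1
  have hmaps : MapsTo (fun s => Real.log s / κ)
      (Icc (Real.exp (κ * t₁)) (Real.exp (κ * T))) (Icc t₁ T) := fun s hs =>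
    ⟨(le_div_iff₀' hκ).2 ((Real.le_log_iff_exp_le (hpos s hs)).2 hs.1),
      (div_le_iff₀' hκ).2 ((Real.log_le_iff_le_exp (hpos s hs)).2 hs.2)⟩
  have hmaps' : ∀ s ∈ Ioo (Real.exp (κ * t₁)) (Real.exp (κ * T)), Real.log s / κ ∈ Ioo 0 T :=
    fun s hs =>
      have hs0 := hpos s (Ioo_subset_Icc_self hs)
      ⟨ht₁.trans_lt ((lt_div_iff₀' hκ).2 ((Real.lt_log_iff_exp_lt hs0).2 hs.1)),
        (div_lt_iff₀' hκ).2 ((Real.log_lt_iff_lt_exp hs0).2 hs.2)⟩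
  have hderiv := fun s (hs : s ∈ Ioo (Real.exp (κ * t₁)) (Real.exp (κ * T))) =>
    h.hasDerivAt_log_norm_sq_add hκ hη (hpos s (Ioo_subset_Icc_self hs)) (hmaps' s hs)
  have hlog : ContinuousOn (fun s => Real.log s / κ)
      (Icc (Real.exp (κ * t₁)) (Real.exp (κ * T))) :=
    (Real.continuousOn_log.mono fun s hs => (hpos s hs).ne').div_const κ
  refine MonotoneOn.convexOn_of_deriv (convex_Icc _ _)
    (((hU.comp hlog hmaps).add continuousOn_const).log fun s _ =>
      (add_pos_of_nonneg_of_pos (sq_nonneg _) hη).ne') ?_ ?_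
  · rw [interior_Icc]
    exact fun s hs => (hderiv s hs).differentiableAt.differentiableWithinAt
  · rw [interior_Icc]
    refine MonotoneOn.congr (fun s hs r hr hsr => ?_) fun s hs => (hderiv s hs).deriv.symm
    have htime : Real.log s / κ ≤ Real.log r / κ := div_le_div_of_nonneg_right
      (Real.log_le_log (hpos s (Ioo_subset_Icc_self hs)) hsr) hκ.le
    exact mul_le_mul_of_nonpos_left
      (h.antitoneOn_exp_mul_frequency hη (hmaps' s hs) (hmaps' r hr) htime)
      (neg_nonpos.2 (by positivity))

end IsEnergyFlow

/-- The weight `θ` for which `exp (κ * t)` is the convex combination of `exp (κ * t₁)` and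
`exp (κ * T)` with coefficients `1 - θ` and `θ`: the flows are logarithmically convex in the time
variable `exp (κ * t)`. -/
noncomputable def expWeight (κ t₁ T t : ℝ) : ℝ :=
  (Real.exp (κ * t) - Real.exp (κ * t₁)) / (Real.exp (κ * T) - Real.exp (κ * t₁))

theorem expWeight_mem_Ioo {κ t₁ t T : ℝ} (hκ : 0 < κ) (h : t ∈ Ioo t₁ T) :
    expWeight κ t₁ T t ∈ Ioo (0 : ℝ) 1 := by
  have h₁ : Real.exp (κ * t₁) < Real.exp (κ * t) := Real.exp_lt_exp.2 (by gcongr; exact h.1)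
  have h₂ : Real.exp (κ * t) < Real.exp (κ * T) := Real.exp_lt_exp.2 (by gcongr; exact h.2)
  exact ⟨div_pos (by linarith) (by linarith), (div_lt_one (by linarith)).2 (by linarith)⟩

theorem mul_le_expWeight_zero {κ t T : ℝ} (hκ : 0 < κ) (hT : 0 < T) :
    κ / (Real.exp (κ * T) - 1) * t ≤ expWeight κ 0 T t := by
  have hden : 0 < Real.exp (κ * T) - 1 := sub_pos.2 (Real.one_lt_exp_iff.2 (mul_pos hκ hT))
  rw [expWeight, mul_zero, Real.exp_zero, div_mul_eq_mul_div]
  gcongr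
  linarith [Real.add_one_le_exp (κ * t)]

theorem convexComb_expWeight {κ t₁ t T : ℝ} (hκ : 0 < κ) (h : t₁ < T) :
    (1 - expWeight κ t₁ T t) * Real.exp (κ * t₁) + expWeight κ t₁ T t * Real.exp (κ * T) =
      Real.exp (κ * t) := by
  have hden : 0 < Real.exp (κ * T) - Real.exp (κ * t₁) :=
    sub_pos.2 (Real.exp_lt_exp.2 (mul_lt_mul_of_pos_left h hκ))
  rw [expWeight]
  field_simp
  ring

namespace IsEnergyFlow

theorem norm_sq_add_le_rpow_mul_rpow (h : IsEnergyFlow T κ U b) (hκ : 0 < κ) {η t₁ t : ℝ}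
    (hη : 0 < η) (ht₁ : 0 ≤ t₁) (hU : ContinuousOn (fun t => ‖U t‖ ^ 2) (Icc t₁ T))
    (ht : t ∈ Ioo t₁ T) :
    ‖U t‖ ^ 2 + η ≤ (‖U t₁‖ ^ 2 + η) ^ (1 - expWeight κ t₁ T t) *
      (‖U T‖ ^ 2 + η) ^ expWeight κ t₁ T t := by
  have hθ := expWeight_mem_Ioo hκ ht
  have hpos : ∀ s, 0 < ‖U s‖ ^ 2 + η := fun s => by positivity
  have htT := ht.1.trans ht.2
  have hexp : Real.exp (κ * t₁) ≤ Real.exp (κ * T) := Real.exp_le_exp.2 (by gcongr)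
  have hconv := (h.convexOn_log_norm_sq_add hκ hη ht₁ hU).2 (left_mem_Icc.2 hexp)
    (right_mem_Icc.2 hexp) (sub_nonneg.2 hθ.2.le) hθ.1.le (sub_add_cancel 1 _)
  simp only [smul_eq_mul, convexComb_expWeight hκ htT, Real.log_exp,
    mul_div_cancel_left₀ _ hκ.ne'] at hconv
  rw [← Real.log_rpow (hpos t₁), ← Real.log_rpow (hpos T),
    ← Real.log_mul (Real.rpow_pos_of_pos (hpos t₁) _).ne'
      (Real.rpow_pos_of_pos (hpos T) _).ne'] at hconv
  exact (Real.log_le_log_iff (hpos t) (mul_pos (Real.rpow_pos_of_pos (hpos t₁) _)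
    (Real.rpow_pos_of_pos (hpos T) _))).1 hconv

theorem norm_le_rpow_mul_rpow (h : IsEnergyFlow T κ U b) (hκ : 0 < κ) {t₁ t : ℝ}
    (ht₁ : 0 ≤ t₁) (hU : ContinuousOn (fun t => ‖U t‖ ^ 2) (Icc t₁ T)) (ht : t ∈ Ioo t₁ T) :
    ‖U t‖ ≤ ‖U t₁‖ ^ (1 - expWeight κ t₁ T t) * ‖U T‖ ^ expWeight κ t₁ T t := by
  have hθ := expWeight_mem_Ioo hκ ht
  have hcont : Continuous fun η : ℝ => (‖U t₁‖ ^ 2 + η) ^ (1 - expWeight κ t₁ T t) *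
      (‖U T‖ ^ 2 + η) ^ expWeight κ t₁ T t :=
    ((continuous_const.add continuous_id).rpow_const fun _ => Or.inr (sub_nonneg.2 hθ.2.le)).mul
      ((continuous_const.add continuous_id).rpow_const fun _ => Or.inr hθ.1.le)
  have hsq : ‖U t‖ ^ 2 ≤ (‖U t₁‖ ^ 2) ^ (1 - expWeight κ t₁ T t) *
      (‖U T‖ ^ 2) ^ expWeight κ t₁ T t := by
    refine ge_of_tendsto (tendsto_nhdsWithin_of_tendsto_nhds (hcont.tendsto' 0 _ (by simp)))
      (eventually_mem_nhdsWithin.mono fun η (hη : η ∈ Ioi 0) => ?_)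
    exact (le_add_of_nonneg_right (le_of_lt hη)).trans
      (h.norm_sq_add_le_rpow_mul_rpow hκ hη ht₁ hU ht)
  rw [← Real.rpow_pow_comm (norm_nonneg _), ← Real.rpow_pow_comm (norm_nonneg _),
    ← mul_pow] at hsq
  exact le_of_sq_le_sq hsq (by positivity)

theorem mul_norm_sq_le_timeL2Norm_sq (h : IsEnergyFlow T κ U b)
    (hU : IntegrableOn (fun t => ‖U t‖ ^ 2) (Ioo 0 T)) {t : ℝ} (ht : t ∈ Ioo 0 T) :
    t * ‖U t‖ ^ 2 ≤ timeL2Norm T U ^ 2 := by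
  have hsub : Ioo 0 t ⊆ Ioo 0 T := Ioo_subset_Ioo_right ht.2.le
  rw [timeL2Norm, Real.sq_sqrt (integral_nonneg fun _ => sq_nonneg _)]
  calc t * ‖U t‖ ^ 2 = ∫ _ in Ioo 0 t, ‖U t‖ ^ 2 := by simp [ht.1.le]
    _ ≤ ∫ s in Ioo 0 t, ‖U s‖ ^ 2 :=
        setIntegral_mono_on (by simp) (hU.mono_set hsub) measurableSet_Ioo fun s hs =>
          h.antitoneOn_norm_sq (hsub hs) ht hs.2.le
    _ ≤ ∫ s in Ioo 0 T, ‖U s‖ ^ 2 :=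
        setIntegral_mono_set hU (Eventually.of_forall fun _ => sq_nonneg _) hsub.eventuallyLE

theorem norm_le_timeL2Norm_rpow_mul_rpow (h : IsEnergyFlow T κ U b) (hκ : 0 < κ)
    (hU : ContinuousOn U (Ioc 0 T)) (hU2 : IntegrableOn (fun t => ‖U t‖ ^ 2) (Ioo 0 T))
    {t₁ t : ℝ} (ht₁ : 0 < t₁) (ht : t ∈ Ioo t₁ T) :
    ‖U t‖ ≤ 1 / √t₁ ^ (1 - expWeight κ t₁ T t) * timeL2Norm T U ^ (1 - expWeight κ t₁ T t) *
      ‖U T‖ ^ expWeight κ t₁ T t := by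
  have hθ := expWeight_mem_Ioo hκ ht
  have hnorm : ‖U t₁‖ ≤ timeL2Norm T U / √t₁ := by
    rw [le_div_iff₀ (Real.sqrt_pos.2 ht₁)]
    refine le_of_sq_le_sq ?_ (timeL2Norm_nonneg T U)
    rw [mul_pow, Real.sq_sqrt ht₁.le, mul_comm]
    exact h.mul_norm_sq_le_timeL2Norm_sq hU2 ⟨ht₁, ht.1.trans ht.2⟩
  calc ‖U t‖ ≤ ‖U t₁‖ ^ (1 - expWeight κ t₁ T t) * ‖U T‖ ^ expWeight κ t₁ T t :=
        h.norm_le_rpow_mul_rpow hκ ht₁.le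
          ((hU.norm.pow 2).mono fun s hs => ⟨ht₁.trans_le hs.1, hs.2⟩) ht
    _ ≤ (timeL2Norm T U / √t₁) ^ (1 - expWeight κ t₁ T t) * ‖U T‖ ^ expWeight κ t₁ T t := by
        have := hθ.2
        gcongr
    _ = _ := by
        rw [Real.div_rpow (timeL2Norm_nonneg T U) (Real.sqrt_nonneg _)]
        ring

theorem norm_sq_le_exp (h : IsEnergyFlow T κ U b) (hκ : 0 < κ)
    (hU : ContinuousOn U (Icc 0 T)) {K S : ℝ} (hK : 1 ≤ K) (hUK : ‖U 0‖ ≤ K) (hS : 0 < S)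
    (hS1 : S < 1) (hUS : ‖U T‖ ≤ S) {t : ℝ} (ht : t ∈ Ioo 0 T) :
    ‖U t‖ ^ 2 ≤ K ^ 2 *
      Real.exp (-(2 * (κ / (Real.exp (κ * T) - 1)) * Real.log (1 / S)) * t) := by
  have hθ := expWeight_mem_Ioo hκ ht
  have hlog : 0 < Real.log (1 / S) := Real.log_pos (one_lt_one_div hS hS1)
  have hinit : ‖U 0‖ ^ (1 - expWeight κ 0 T t) ≤ K :=
    calc ‖U 0‖ ^ (1 - expWeight κ 0 T t) ≤ K ^ (1 - expWeight κ 0 T t) :=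
          Real.rpow_le_rpow (norm_nonneg _) hUK (sub_nonneg.2 hθ.2.le)
      _ ≤ K ^ (1 : ℝ) := Real.rpow_le_rpow_of_exponent_le hK (by linarith [hθ.1])
      _ = K := Real.rpow_one K
  have hfinal : ‖U T‖ ^ expWeight κ 0 T t ≤
      Real.exp (-(Real.log (1 / S) * (κ / (Real.exp (κ * T) - 1) * t))) :=
    calc ‖U T‖ ^ expWeight κ 0 T t ≤ S ^ expWeight κ 0 T t :=
          Real.rpow_le_rpow (norm_nonneg _) hUS hθ.1.le
      _ = Real.exp (-(Real.log (1 / S) * expWeight κ 0 T t)) := by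
          rw [Real.rpow_def_of_pos hS, one_div, Real.log_inv, neg_mul, neg_neg]
      _ ≤ _ := by
          have := mul_le_expWeight_zero (t := t) hκ (ht.1.trans ht.2)
          gcongr
  calc ‖U t‖ ^ 2 ≤ (‖U 0‖ ^ (1 - expWeight κ 0 T t) * ‖U T‖ ^ expWeight κ 0 T t) ^ 2 := by
        gcongr
        exact h.norm_le_rpow_mul_rpow hκ le_rfl (hU.norm.pow 2) ht
    _ ≤ (K * Real.exp (-(Real.log (1 / S) * (κ / (Real.exp (κ * T) - 1) * t)))) ^ 2 := by gcongr
    _ = _ := by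
        rw [mul_pow, ← Real.exp_nat_mul]
        push_cast
        ring_nf

theorem timeL2Norm_le (h : IsEnergyFlow T κ U b) (hκ : 0 < κ) (hT : 0 < T)
    (hU : ContinuousOn U (Icc 0 T)) {K S : ℝ} (hK : 1 ≤ K) (hUK : ‖U 0‖ ≤ K) (hS : 0 < S)
    (hS1 : S < 1) (hUS : ‖U T‖ ≤ S) :
    timeL2Norm T U ≤ (2 * (κ / (Real.exp (κ * T) - 1))) ^ (-(1 / 2) : ℝ) * K *
      Real.log (1 / S) ^ (-(1 / 2) : ℝ) := by
  have hlog : 0 < Real.log (1 / S) := Real.log_pos (one_lt_one_div hS hS1)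
  have hc : 0 < 2 * (κ / (Real.exp (κ * T) - 1)) :=
    mul_pos two_pos (div_pos hκ (sub_pos.2 (Real.one_lt_exp_iff.2 (mul_pos hκ hT))))
  refine (timeL2Norm_le_of_norm_sq_le_exp (zero_le_one.trans hK) (mul_pos hc hlog) fun t ht =>
    h.norm_sq_le_exp hκ hU hK hUK hS hS1 hUS ht).trans_eq ?_
  rw [Real.mul_rpow hc.le hlog.le]
  ring

end IsEnergyFlow

end EnergyFlow

section WeakDerivative

variable {E : Type*} [NormedAddCommGroup E] [NormedSpace ℝ E] {s : Set ℝ} {φ ψ : ℝ → ℝ} {T : ℝ}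
  {w w' : ℝ → E}

theorem hasDerivAt_integral_Iic [CompleteSpace E] (hw : Continuous w) (hwi : Integrable w) (x : ℝ) :
    HasDerivAt (fun x => ∫ y in Iic x, w y) (w x) x := by
  have hprim : (fun x => ∫ y in Iic x, w y) = fun x => (∫ y in Iic 0, w y) + ∫ y in 0..x, w y := by
    ext x
    rw [← intervalIntegral.integral_Iic_sub_Iic hwi.integrableOn hwi.integrableOn,
      add_sub_cancel]
  rw [hprim]
  exact (hw.integral_hasStrictDerivAt 0 x).hasDerivAt.const_add _

/-- `φ` is a test function on `s`: smooth, with compact support contained in `s`. -/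
structure IsTestFunction (s : Set ℝ) (φ : ℝ → ℝ) : Prop where
  contDiff : ContDiff ℝ ∞ φ
  hasCompactSupport : HasCompactSupport φ
  tsupport_subset : tsupport φ ⊆ s

theorem IsWeakTimeDeriv.integral_deriv_smul (h : IsWeakTimeDeriv T w w')
    (hφ : IsTestFunction (Ioo 0 T) φ) :
    ∫ t in Ioo 0 T, deriv φ t • w t = -∫ t in Ioo 0 T, φ t • w' t :=
  h φ hφ.contDiff hφ.hasCompactSupport hφ.tsupport_subset

namespace IsTestFunction

theorem deriv (hφ : IsTestFunction s φ) : IsTestFunction s (deriv φ) where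
  contDiff := (contDiff_infty_iff_deriv.1 hφ.contDiff).2
  hasCompactSupport := hφ.hasCompactSupport.deriv
  tsupport_subset := tsupport_deriv_subset.trans hφ.tsupport_subset

theorem sub_const_mul (hψ : IsTestFunction s ψ) (hφ : IsTestFunction s φ) (c : ℝ) :
    IsTestFunction s fun x => ψ x - c * φ x where
  contDiff := hψ.contDiff.sub (contDiff_const.mul hφ.contDiff)
  hasCompactSupport := hψ.hasCompactSupport.sub hφ.hasCompactSupport.mul_left
  tsupport_subset := (tsupport_sub ψ fun x => c * φ x).trans <| union_subset hψ.tsupport_subset <|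
    (tsupport_mul_subset_right (f := fun _ => c)).trans hφ.tsupport_subset

theorem integrable (hφ : IsTestFunction s φ) : Integrable φ :=
  hφ.contDiff.continuous.integrable_of_hasCompactSupport hφ.hasCompactSupport

theorem integrable_smul (hφ : IsTestFunction s φ) (hs : IsOpen s) (hw : ContinuousOn w s) :
    Integrable fun x => φ x • w x := by
  refine Continuous.integrable_of_hasCompactSupport (continuous_of_tsupport fun x hx => ?_)
    hφ.hasCompactSupport.smul_right
  exact hφ.contDiff.continuous.continuousAt.smul (hw.continuousAt
    (hs.mem_nhds (hφ.tsupport_subset (tsupport_smul_subset_left φ w hx))))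

theorem setIntegral_smul (hφ : IsTestFunction s φ) (w : ℝ → E) :
    ∫ x in s, φ x • w x = ∫ x, φ x • w x :=
  setIntegral_eq_integral_of_forall_compl_eq_zero fun x hx => by
    rw [image_eq_zero_of_notMem_tsupport fun h => hx (hφ.tsupport_subset h), zero_smul]

theorem hasDerivAt_smul (hφ : IsTestFunction s φ) (hw : ∀ x ∈ s, HasDerivAt w (w' x) x) (x : ℝ) :
    HasDerivAt (fun x => φ x • w x) (φ x • w' x + _root_.deriv φ x • w x) x := by
  by_cases hx : x ∈ tsupport φ
  · exact (hφ.contDiff.differentiable (by simp) x).hasDerivAt.fun_smul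
      (hw x (hφ.tsupport_subset hx))
  · rw [image_eq_zero_of_notMem_tsupport hx,
      image_eq_zero_of_notMem_tsupport fun h => hx (tsupport_deriv_subset h), zero_smul, zero_smul,
      add_zero]
    exact .of_notMem_tsupport fun h => hx (tsupport_smul_subset_left φ w h)

theorem setIntegral_deriv_smul (hφ : IsTestFunction s φ) (hs : IsOpen s)
    (hw' : ContinuousOn w' s) (hw : ∀ x ∈ s, HasDerivAt w (w' x) x) :
    ∫ x in s, _root_.deriv φ x • w x = -∫ x in s, φ x • w' x := by
  have hwc : ContinuousOn w s := fun x hx => (hw x hx).continuousAt.continuousWithinAt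
  have hφ'w := hφ.deriv.integrable_smul hs hwc
  have hφw' := hφ.integrable_smul hs hw'
  have hzero := integral_eq_zero_of_hasDerivAt_of_integrable (hφ.hasDerivAt_smul hw)
    (hφw'.add hφ'w) (hφ.integrable_smul hs hwc)
  rw [integral_add hφw' hφ'w] at hzero
  rw [hφ.deriv.setIntegral_smul, hφ.setIntegral_smul]
  exact eq_neg_of_add_eq_zero_right hzero

theorem exists_support_integral_Iic_subset (hψ : IsTestFunction s ψ) (hs : OrdConnected s)
    (hψ0 : ∫ x, ψ x = 0) :
    ∃ K ⊆ s, IsCompact K ∧ Function.support (fun x => ∫ y in Iic x, ψ y) ⊆ K := by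
  have hzero : ∀ x, (∀ y ∈ Iic x, ψ y = 0) → ∫ y in Iic x, ψ y = 0 := fun x =>
    setIntegral_eq_zero_of_forall_eq_zero
  rcases (tsupport ψ).eq_empty_or_nonempty with hne | hne
  · refine ⟨∅, empty_subset s, isCompact_empty, fun x hx => hx (hzero x fun y _ => ?_)⟩
    rw [tsupport_eq_empty_iff.1 hne, Pi.zero_apply]
  have hK : IsCompact (tsupport ψ) := hψ.hasCompactSupport
  obtain ⟨a, ha, hmin⟩ := hK.exists_isLeast hne
  obtain ⟨b, hb, hmax⟩ := hK.exists_isGreatest hne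
  refine ⟨Icc a b, hs.out (hψ.tsupport_subset ha) (hψ.tsupport_subset hb), isCompact_Icc,
    fun x => not_imp_not.1 fun hx => Function.notMem_support.2 ?_⟩
  by_cases hleft : ∀ y ∈ Iic x, ψ y = 0
  · exact hzero x hleft
  push Not at hleft
  obtain ⟨y, hyx, hy⟩ := hleft
  rw [setIntegral_eq_integral_of_forall_compl_eq_zero fun z hz => ?_, hψ0]
  by_contra hz0
  exact hx ⟨(hmin (subset_tsupport ψ hy)).trans hyx,
    (not_le.1 hz).le.trans (hmax (subset_tsupport ψ hz0))⟩

theorem exists_deriv_eq (hψ : IsTestFunction s ψ) (hs : OrdConnected s)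
    (hψ0 : ∫ x, ψ x = 0) :
    ∃ φ, IsTestFunction s φ ∧ _root_.deriv φ = ψ := by
  obtain ⟨K, hKs, hK, hsupp⟩ := hψ.exists_support_integral_Iic_subset hs hψ0
  have hderiv := hasDerivAt_integral_Iic hψ.contDiff.continuous hψ.integrable
  have hderiv_eq := funext fun x => (hderiv x).deriv
  refine ⟨fun x => ∫ y in Iic x, ψ y, ⟨?_, .of_support_subset_isCompact hK hsupp,
    (closure_minimal hsupp hK.isClosed).trans hKs⟩, hderiv_eq⟩
  exact contDiff_infty_iff_deriv.2 ⟨fun x => (hderiv x).differentiableAt,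
    hderiv_eq.symm ▸ hψ.contDiff⟩

end IsTestFunction

theorem isTestFunction_normed {c : ℝ} (f : ContDiffBump c)
    (hs : Metric.closedBall c f.rOut ⊆ s) : IsTestFunction s (f.normed volume) where
  contDiff := f.contDiff_normed
  hasCompactSupport := f.hasCompactSupport_normed
  tsupport_subset := (f.tsupport_normed_eq (μ := volume)).trans_subset hs

theorem exists_eqOn_const_of_integral_deriv_smul_eq_zero [CompleteSpace E] (hso : IsOpen s)
    (hs : OrdConnected s) (hw : ContinuousOn w s)
    (h : ∀ φ, IsTestFunction s φ → ∫ x in s, deriv φ x • w x = 0) :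
    ∃ c, EqOn w (fun _ => c) s := by
  rcases s.eq_empty_or_nonempty with rfl | ⟨x₀, hx₀⟩
  · exact ⟨0, eqOn_empty _ _⟩
  obtain ⟨d, hd, hds⟩ := Metric.nhds_basis_closedBall.mem_iff.1 (hso.mem_nhds hx₀)
  let f : ContDiffBump x₀ := ⟨d / 2, d, half_pos hd, half_lt_self hd⟩
  have hρ : IsTestFunction s (f.normed volume) := isTestFunction_normed f hds
  set c : E := ∫ x, f.normed volume x • w x
  refine ⟨c, Measure.eqOn_open_of_ae_eq (μ := volume)
    ((ae_restrict_iff' hso.measurableSet).2 ?_) hso hw continuousOn_const⟩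
  have hae := hso.ae_eq_zero_of_integral_contDiff_smul_eq_zero (μ := volume)
    ((hw.sub (continuousOn_const (c := c))).locallyIntegrableOn hso.measurableSet)
    fun ψ hψd hψc hψs => ?_
  · exact hae.mono fun x hx hxs => sub_eq_zero.1 (hx hxs)
  have hψ : IsTestFunction s ψ := ⟨hψd, hψc, hψs⟩
  obtain ⟨φ, hφ, hφψ⟩ := (hψ.sub_const_mul hρ (∫ x, ψ x)).exists_deriv_eq hs <| by
    rw [integral_sub hψ.integrable (hρ.integrable.const_mul _), integral_const_mul,
      f.integral_normed, mul_one, sub_self]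
  have hzero := h φ hφ
  rw [hφ.deriv.setIntegral_smul, hφψ] at hzero
  simp only [sub_smul, mul_smul] at hzero
  rw [integral_sub (hψ.integrable_smul hso hw) ((hρ.integrable_smul hso hw).fun_smul _),
    integral_smul] at hzero
  simp only [Pi.sub_apply, smul_sub]
  rw [integral_sub (hψ.integrable_smul hso hw) (hψ.integrable.smul_const _),
    integral_smul_const, hzero]

namespace IsWeakTimeDeriv

theorem hasDerivAt [CompleteSpace E] (h : IsWeakTimeDeriv T w w') (hw : ContinuousOn w (Ioo 0 T))
    (hw' : ContinuousOn w' (Ioo 0 T)) {x : ℝ} (hx : x ∈ Ioo 0 T) : HasDerivAt w (w' x) x := by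
  have hW : ∀ y ∈ Ioo 0 T, HasDerivAt (fun y => ∫ t in x..y, w' t) (w' y) y := fun y hy =>
    intervalIntegral.integral_hasDerivAt_right
      (hw'.mono (ordConnected_Ioo.uIcc_subset hx hy)).intervalIntegrable
      (hw'.stronglyMeasurableAtFilter isOpen_Ioo y hy) (hw'.continuousAt (isOpen_Ioo.mem_nhds hy))
  have hWc : ContinuousOn (fun y => ∫ t in x..y, w' t) (Ioo 0 T) := fun y hy =>
    (hW y hy).continuousAt.continuousWithinAt
  obtain ⟨c, hc⟩ := exists_eqOn_const_of_integral_deriv_smul_eq_zero isOpen_Ioo ordConnected_Ioo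
    (hw.sub hWc) fun φ hφ => by
      simp only [Pi.sub_apply, smul_sub]
      rw [integral_sub (hφ.deriv.integrable_smul isOpen_Ioo hw).integrableOn
        (hφ.deriv.integrable_smul isOpen_Ioo hWc).integrableOn, h.integral_deriv_smul hφ,
        hφ.setIntegral_deriv_smul isOpen_Ioo hw' hW, sub_self]
  refine ((hW x hx).const_add c).congr_of_eventuallyEq ?_
  filter_upwards [isOpen_Ioo.mem_nhds hx] with y hy
  exact sub_eq_iff_eq_add.1 (hc hy)

theorem congr_right {w'' : ℝ → E} (h : IsWeakTimeDeriv T w w')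
    (hw : w' =ᵐ[volume.restrict (Ioo 0 T)] w'') : IsWeakTimeDeriv T w w'' :=
  fun φ hφ hφc hφs => (h φ hφ hφc hφs).trans <| congrArg Neg.neg <| integral_congr_ae <|
    hw.mono fun t ht => congrArg (φ t • ·) ht

theorem comp_clm {F : Type*} [NormedAddCommGroup F] [NormedSpace ℝ F] [CompleteSpace E]
    [CompleteSpace F] (h : IsWeakTimeDeriv T w w') (L : E →L[ℝ] F)
    (hw : IntegrableOn w (Ioo 0 T)) (hw' : IntegrableOn w' (Ioo 0 T)) :
    IsWeakTimeDeriv T (fun t => L (w t)) fun t => L (w' t) := by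
  have hcomm : ∀ {φ : ℝ → ℝ} {v : ℝ → E}, IsTestFunction (Ioo 0 T) φ → IntegrableOn v (Ioo 0 T) →
      ∫ t in Ioo 0 T, φ t • L (v t) = L (∫ t in Ioo 0 T, φ t • v t) := fun hφ hv => by
    obtain ⟨C, hC⟩ :=
      hφ.contDiff.continuous.bounded_above_of_compact_support hφ.hasCompactSupport
    have := L.integral_comp_comm (hv.bdd_smul C hφ.contDiff.continuous.aestronglyMeasurable
      (Eventually.of_forall hC))
    simpa using this
  intro φ hφ hφc hφs
  have hφ' : IsTestFunction (Ioo 0 T) φ := ⟨hφ, hφc, hφs⟩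
  rw [hcomm hφ'.deriv hw, hcomm hφ' hw', h.integral_deriv_smul hφ', map_neg]

end IsWeakTimeDeriv

end WeakDerivative

section WeightedForms

variable {Z : Type*} [MeasurableSpace Z] {ν : Measure Z} {ι : Type*} {l : Filter ι}

theorem tendsto_eLpNorm_mul_sub_mul {F G : ι → Z → ℝ} {f g : Z → ℝ} (hF : ∀ i, MemLp (F i) 2 ν)
    (hG : ∀ i, MemLp (G i) 2 ν) (hf : MemLp f 2 ν) (hg : MemLp g 2 ν)
    (hFf : Tendsto (fun i => eLpNorm (F i - f) 2 ν) l (𝓝 0))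
    (hGg : Tendsto (fun i => eLpNorm (G i - g) 2 ν) l (𝓝 0)) :
    Tendsto (fun i => eLpNorm (F i * G i - f * g) 1 ν) l (𝓝 0) := by
  have hbound : ∀ i, eLpNorm (F i * G i - f * g) 1 ν ≤
      eLpNorm (F i - f) 2 ν * (eLpNorm (G i - g) 2 ν + eLpNorm g 2 ν) +
        eLpNorm f 2 ν * eLpNorm (G i - g) 2 ν := fun i => by
    have hdecomp : F i * G i - f * g = (F i - f) • ((G i - g) + g) + f • (G i - g) := by
      simp only [smul_eq_mul]
      ring
    have hGi := (hG i).sub hg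
    have hFi := (hF i).sub hf
    rw [hdecomp]
    refine (eLpNorm_add_le (hFi.1.smul (hGi.1.add hg.1)) (hf.1.smul hGi.1) le_rfl).trans ?_
    gcongr
    · exact (eLpNorm_smul_le_mul_eLpNorm (hGi.1.add hg.1) hFi.1).trans
        (mul_le_mul_right (eLpNorm_add_le hGi.1 hg.1 one_le_two) _)
    · exact eLpNorm_smul_le_mul_eLpNorm hGi.1 hf.1
  refine tendsto_of_tendsto_of_tendsto_of_le_of_le tendsto_const_nhds ?_ (fun _ => zero_le) hbound
  have hzero : 0 = 0 * (0 + eLpNorm g 2 ν) + eLpNorm f 2 ν * 0 := by simp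
  rw [hzero]
  exact (ENNReal.Tendsto.mul hFf (Or.inr (by simpa using hg.eLpNorm_ne_top))
    (hGg.add_const _) (Or.inr ENNReal.zero_ne_top)).add
    (ENNReal.Tendsto.const_mul hGg (Or.inr hf.eLpNorm_ne_top))

theorem tendsto_integral_mul_of_tendsto_eLpNorm [l.IsCountablyGenerated] {k : ι → Z → ℝ}
    {k₀ : Z → ℝ} {M : ℝ} {F : ι → Z → ℝ} {f : Z → ℝ} (hk : ∀ i, AEStronglyMeasurable (k i) ν)
    (hkM : ∀ i, ∀ᵐ z ∂ν, ‖k i z‖ ≤ M) (hkk : ∀ᵐ z ∂ν, Tendsto (fun i => k i z) l (𝓝 (k₀ z)))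
    (hF : ∀ i, Integrable (F i) ν) (hf : Integrable f ν)
    (hFf : Tendsto (fun i => eLpNorm (F i - f) 1 ν) l (𝓝 0)) :
    Tendsto (fun i => ∫ z, k i z * F i z ∂ν) l (𝓝 (∫ z, k₀ z * f z ∂ν)) := by
  have hlim : Tendsto (fun i => ∫ z, k i z * f z ∂ν) l (𝓝 (∫ z, k₀ z * f z ∂ν)) :=
    tendsto_integral_filter_of_dominated_convergence (fun z => M * ‖f z‖)
      (Eventually.of_forall fun i => (hk i).mul hf.1)
      (Eventually.of_forall fun i => (hkM i).mono fun z hz => by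
        rw [norm_mul]
        gcongr)
      (hf.norm.const_mul M) (hkk.mono fun z hz => hz.mul_const _)
  have herr : Tendsto (fun i => ∫ z, k i z * (F i - f) z ∂ν) l (𝓝 0) := by
    rw [← integral_zero Z ℝ (μ := ν)]
    refine tendsto_integral_of_L1' _ aestronglyMeasurable_const
      (Eventually.of_forall fun i => ((hF i).sub hf).bdd_mul (hk i) (hkM i)) ?_
    have hM : Tendsto (fun i => ENNReal.ofReal M * eLpNorm (F i - f) 1 ν) l (𝓝 0) := by
      simpa using ENNReal.Tendsto.const_mul hFf (Or.inr ENNReal.ofReal_ne_top)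
    refine tendsto_of_tendsto_of_tendsto_of_le_of_le tendsto_const_nhds hM (fun _ => zero_le)
      fun i => ?_
    refine eLpNorm_le_mul_eLpNorm_of_ae_le_mul ((hkM i).mono fun z hz => ?_) 1
    simp only [Pi.sub_apply, sub_zero, norm_mul]
    gcongr
  convert hlim.add herr using 2 with i
  · rw [← integral_add (hf.bdd_mul (hk i) (hkM i)) (((hF i).sub hf).bdd_mul (hk i) (hkM i))]
    simp [← mul_add]
  · simp

variable {s : Set ℝ} {k : ℝ → Z → ℝ} {D : ℝ → Z → ℝ} {M : ℝ}

theorem continuousOn_integral_mul_mul (hk : ∀ t ∈ s, AEStronglyMeasurable (k t) ν)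
    (hkM : ∀ t ∈ s, ∀ᵐ z ∂ν, ‖k t z‖ ≤ M) (hkc : ∀ᵐ z ∂ν, ContinuousOn (fun t => k t z) s)
    (hD : ∀ t ∈ s, MemLp (D t) 2 ν)
    (hDc : ∀ t ∈ s, Tendsto (fun r => eLpNorm (D r - D t) 2 ν) (𝓝[s] t) (𝓝 0)) :
    ContinuousOn (Function.uncurry fun r t => ∫ z, k r z * (D r z * D t z) ∂ν) (s ×ˢ s) := by
  rw [continuousOn_iff_continuous_domRestrict, continuous_iff_continuousAt]
  rintro ⟨⟨r, t⟩, hr, ht⟩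
  have hfst : Tendsto (fun p : s ×ˢ s => (p : ℝ × ℝ).1) (𝓝 ⟨(r, t), hr, ht⟩) (𝓝[s] r) :=
    tendsto_nhdsWithin_iff.2 ⟨(continuous_fst.comp continuous_subtype_val).tendsto _,
      Eventually.of_forall fun p => p.2.1⟩
  have hsnd : Tendsto (fun p : s ×ˢ s => (p : ℝ × ℝ).2) (𝓝 ⟨(r, t), hr, ht⟩) (𝓝[s] t) :=
    tendsto_nhdsWithin_iff.2 ⟨(continuous_snd.comp continuous_subtype_val).tendsto _,
      Eventually.of_forall fun p => p.2.2⟩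
  exact tendsto_integral_mul_of_tendsto_eLpNorm (fun p => hk _ p.2.1) (fun p => hkM _ p.2.1)
    (hkc.mono fun z hz => (hz r hr).tendsto.comp hfst)
    (fun p => (hD _ p.2.1).integrable_mul (hD _ p.2.2)) ((hD r hr).integrable_mul (hD t ht))
    (tendsto_eLpNorm_mul_sub_mul (fun p => hD _ p.2.1) (fun p => hD _ p.2.2) (hD r hr) (hD t ht)
      ((hDc r hr).comp hfst) ((hDc t ht).comp hsnd))

theorem two_mul_integral_sub_integral_le {k k' f g : Z → ℝ} {M c : ℝ}
    (hk : AEStronglyMeasurable k ν) (hkM : ∀ᵐ z ∂ν, ‖k z‖ ≤ M) (hk' : AEStronglyMeasurable k' ν)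
    (hkM' : ∀ᵐ z ∂ν, ‖k' z‖ ≤ M) (hf : MemLp f 2 ν) (hg : MemLp g 2 ν)
    (hk0 : ∀ᵐ z ∂ν, 0 ≤ k z) (hkk : ∀ᵐ z ∂ν, k z ≤ c * k' z) :
    2 * ∫ z, k z * (f z * g z) ∂ν - ∫ z, k z * (f z * f z) ∂ν ≤
      c * ∫ z, k' z * (g z * g z) ∂ν := by
  have hfg := ((hf.integrable_mul hg).bdd_mul hk hkM).const_mul 2
  have hff := (hf.integrable_mul hf).bdd_mul hk hkM
  have hgg := ((hg.integrable_mul hg).bdd_mul hk' hkM').const_mul c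
  simp only [Pi.mul_apply] at hfg hff hgg
  rw [← integral_const_mul, ← integral_sub hfg hff, ← integral_const_mul]
  refine integral_mono_ae (hfg.sub hff) hgg ?_
  filter_upwards [hk0, hkk] with z hz0 hz
  calc 2 * (k z * (f z * g z)) - k z * (f z * f z)
      ≤ 2 * (k z * (f z * g z)) - k z * (f z * f z) + k z * (f z - g z) ^ 2 :=
        le_add_of_nonneg_right (by positivity)
    _ = k z * (g z * g z) := by ring
    _ ≤ c * k' z * (g z * g z) := mul_le_mul_of_nonneg_right hz (mul_self_nonneg _)
    _ = c * (k' z * (g z * g z)) := by ring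

end WeightedForms

noncomputable section Kernel

variable {n : ℕ} {Ω : Set (Rn n)} {ε : ℝ≥0∞} {T alo ahi t : ℝ} {β : Rn n → ℝ}
  {a : ℝ → Rn n → Rn n → Matrix (Fin n) (Fin n) ℝ}

/-- The unit vector pointing from `x` to `y`, truncated to `0` beyond the horizon `ε` (and equal to
`0` for `y = x`). -/
def direction (ε : ℝ≥0∞) (x y : Rn n) : Fin n → ℝ :=
  open Classical in
  if edist y x ≤ ε then fun i => (y i - x i) / ‖y - x‖ else 0

/-- The coefficient of the diffusion tensor along the segment of the pair `z`. With it the energy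
form reads `∫ directionalCoeff a ε t * (diffQuotient β v * diffQuotient β w)`, so that `B_t` depends
on `t` through a bounded weight only. -/
def directionalCoeff (a : ℝ → Rn n → Rn n → Matrix (Fin n) (Fin n) ℝ) (ε : ℝ≥0∞) (t : ℝ)
    (z : Rn n × Rn n) : ℝ :=
  direction ε z.1 z.2 ⬝ᵥ (a t z.1 z.2 *ᵥ direction ε z.1 z.2)

/-- The difference quotient of order `n / 2 + β(x)` of `v` at the pair `z = (x, y)`. Its `L²` norm
over `Ω̃ × Ω̃` is the seminorm of `H^{β(·)}(Ω̃)`. -/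
def diffQuotient (β : Rn n → ℝ) (v : Rn n → ℝ) (z : Rn n × Rn n) : ℝ :=
  (v z.2 - v z.1) / ‖z.2 - z.1‖ ^ ((n : ℝ) / 2 + β z.1)

/-- Lebesgue measure on `Ω̃ × Ω̃`. -/
abbrev pairMeasure (Ω : Set (Rn n)) (ε : ℝ≥0∞) : Measure (Rn n × Rn n) :=
  (volume.restrict (tildeDomain Ω ε)).prod (volume.restrict (tildeDomain Ω ε))

open scoped Pointwise in
theorem tildeDomain_eq_add (Ω : Set (Rn n)) (ε : ℝ≥0∞) :
    tildeDomain Ω ε = Ω + {w : Rn n | edist w 0 ≤ ε} := by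
  ext y
  simp only [tildeDomain, interactionDomain, mem_union, mem_ofPred_eq, Set.mem_add]
  constructor
  · rintro (hy | ⟨-, x, hx, hxy⟩)
    · exact ⟨y, hy, 0, by simp, add_zero y⟩
    · exact ⟨x, hx, y - x, by rwa [edist_zero_right, ← edist_eq_enorm_sub], by abel⟩
  · rintro ⟨x, hx, w, hw, rfl⟩
    by_cases hy : x + w ∈ Ω
    · exact Or.inl hy
    · exact Or.inr ⟨hy, x, hx, by simpa [edist_eq_enorm_sub] using hw⟩

theorem isOpen_tildeDomain (hΩ : IsOpen Ω) (ε : ℝ≥0∞) : IsOpen (tildeDomain Ω ε) :=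
  tildeDomain_eq_add Ω ε ▸ hΩ.add_right

theorem ae_pairMeasure (hΩ : MeasurableSet (tildeDomain Ω ε)) {p : Rn n × Rn n → Prop}
    (hp : ∀ x ∈ tildeDomain Ω ε, ∀ y ∈ tildeDomain Ω ε, p (x, y)) :
    ∀ᵐ z ∂(pairMeasure Ω ε), p z := by
  rw [pairMeasure, Measure.prod_restrict]
  exact ae_restrict_of_forall_mem (hΩ.prod hΩ) fun z hz => hp z.1 hz.1 z.2 hz.2

theorem sum_sq_direction_le_one (ε : ℝ≥0∞) (x y : Rn n) : ∑ i, direction ε x y i ^ 2 ≤ 1 := by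
  unfold direction
  split_ifs
  · have hsum : ∑ i, (y i - x i) ^ 2 = ‖y - x‖ ^ 2 := by simp [EuclideanSpace.norm_sq_eq]
    simp only [div_pow]
    rw [← Finset.sum_div, hsum]
    exact div_self_le_one _
  · simp

theorem directionalCoeff_eq_sum (a : ℝ → Rn n → Rn n → Matrix (Fin n) (Fin n) ℝ) (ε : ℝ≥0∞)
    (t : ℝ) (z : Rn n × Rn n) : directionalCoeff a ε t z =
      ∑ i, ∑ j, a t z.1 z.2 i j * direction ε z.1 z.2 i * direction ε z.1 z.2 j := by
  simp only [directionalCoeff, dotProduct, Matrix.mulVec, Finset.mul_sum]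
  exact Finset.sum_congr rfl fun i _ => Finset.sum_congr rfl fun j _ => by ring

theorem directionalCoeff_of_lt {x y : Rn n} (h : ¬edist y x ≤ ε) :
    directionalCoeff a ε t (x, y) = 0 := by
  simp [directionalCoeff, direction, h]

namespace IsTensor

theorem le_directionalCoeff (ha : IsTensor Ω ε T alo ahi a) (ht : t ∈ Icc 0 T) {x y : Rn n}
    (hx : x ∈ tildeDomain Ω ε) (hy : y ∈ tildeDomain Ω ε) :
    alo * ∑ i, direction ε x y i ^ 2 ≤ directionalCoeff a ε t (x, y) := by
  by_cases h : edist y x ≤ ε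
  · rw [directionalCoeff_eq_sum]
    exact ha.lower t ht x hx y hy h _
  · rw [directionalCoeff_of_lt h]
    simp [direction, h]

theorem directionalCoeff_nonneg (ha : IsTensor Ω ε T alo ahi a) (halo : 0 ≤ alo)
    (ht : t ∈ Icc 0 T) {x y : Rn n} (hx : x ∈ tildeDomain Ω ε) (hy : y ∈ tildeDomain Ω ε) :
    0 ≤ directionalCoeff a ε t (x, y) :=
  (mul_nonneg halo (Finset.sum_nonneg fun _ _ => sq_nonneg _)).trans
    (ha.le_directionalCoeff ht hx hy)

theorem directionalCoeff_le (ha : IsTensor Ω ε T alo ahi a) (hahi : 0 ≤ ahi) (ht : t ∈ Icc 0 T)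
    {x y : Rn n} (hx : x ∈ tildeDomain Ω ε) (hy : y ∈ tildeDomain Ω ε) :
    directionalCoeff a ε t (x, y) ≤ ahi := by
  by_cases h : edist y x ≤ ε
  · rw [directionalCoeff_eq_sum]
    exact (ha.upper t ht x hx y hy h _).trans
      (mul_le_of_le_one_right hahi (sum_sq_direction_le_one ε x y))
  · rwa [directionalCoeff_of_lt h]

theorem contDiffOn_time (ha : IsTensor Ω ε T alo ahi a) (x y : Rn n) (i j : Fin n) :
    ContDiffOn ℝ 1 (fun t => a t x y i j) (Icc 0 T) :=
  (ha.contDiffOn i j).comp (f := fun t : ℝ => (t, x, y))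
    (contDiff_id.prodMk contDiff_const).contDiffOn fun _ ht => ⟨ht, mem_univ _⟩

theorem hasDerivWithinAt_directionalCoeff (ha : IsTensor Ω ε T alo ahi a) (ht : t ∈ Icc 0 T)
    (z : Rn n × Rn n) : HasDerivWithinAt (fun t => directionalCoeff a ε t z)
      (∑ i, ∑ j, derivWithin (fun s => a s z.1 z.2 i j) (Icc 0 T) t *
        direction ε z.1 z.2 i * direction ε z.1 z.2 j) (Icc 0 T) t := by
  simp only [directionalCoeff_eq_sum]
  exact HasDerivWithinAt.fun_sum fun i _ => HasDerivWithinAt.fun_sum fun j _ =>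
    ((((ha.contDiffOn_time z.1 z.2 i j).differentiableOn one_ne_zero t
      ht).hasDerivWithinAt).mul_const _).mul_const _

theorem continuousOn_directionalCoeff (ha : IsTensor Ω ε T alo ahi a) (z : Rn n × Rn n) :
    ContinuousOn (fun t => directionalCoeff a ε t z) (Icc 0 T) := fun _ ht =>
  (ha.hasDerivWithinAt_directionalCoeff ht z).continuousWithinAt

theorem directionalCoeff_sub_le (ha : IsTensor Ω ε T alo ahi a) {r : ℝ} (ht : t ∈ Icc 0 T)
    (hr : r ∈ Icc 0 T) (htr : t ≤ r) {x y : Rn n} (hx : x ∈ tildeDomain Ω ε)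
    (hy : y ∈ tildeDomain Ω ε) : directionalCoeff a ε r (x, y) - directionalCoeff a ε t (x, y) ≤
      ahi * (∑ i, direction ε x y i ^ 2) * (r - t) := by
  by_cases h : edist y x ≤ ε
  · have hderiv : ∀ s ∈ interior (Icc 0 T),
        HasDerivAt (fun t => directionalCoeff a ε t (x, y)) _ s := fun s hs =>
      (ha.hasDerivWithinAt_directionalCoeff (interior_subset hs) (x, y)).hasDerivAt
        (mem_interior_iff_mem_nhds.1 hs)
    refine (convex_Icc 0 T).image_sub_le_mul_sub_of_deriv_le
      (ha.continuousOn_directionalCoeff (x, y))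
      (fun s hs => (hderiv s hs).differentiableAt.differentiableWithinAt) (fun s hs => ?_)
      t ht r hr htr
    rw [(hderiv s hs).deriv]
    exact ha.deriv_upper s (interior_subset hs) x hx y hy h _
  · simp [directionalCoeff_of_lt h, direction, h]

theorem directionalCoeff_growth (ha : IsTensor Ω ε T alo ahi a) (halo : 0 < alo) (hahi : 0 ≤ ahi)
    {r : ℝ} (ht : t ∈ Icc 0 T) (hr : r ∈ Icc 0 T) (htr : t ≤ r) {x y : Rn n}
    (hx : x ∈ tildeDomain Ω ε) (hy : y ∈ tildeDomain Ω ε) :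
    directionalCoeff a ε r (x, y) ≤
      (1 + ahi / alo * (r - t)) * directionalCoeff a ε t (x, y) := by
  have : 0 ≤ r - t := sub_nonneg.2 htr
  calc directionalCoeff a ε r (x, y)
      ≤ directionalCoeff a ε t (x, y) + ahi * (∑ i, direction ε x y i ^ 2) * (r - t) :=
        sub_le_iff_le_add'.1 (ha.directionalCoeff_sub_le ht hr htr hx hy)
    _ = directionalCoeff a ε t (x, y) +
          ahi / alo * (alo * ∑ i, direction ε x y i ^ 2) * (r - t) := by field_simp
    _ ≤ directionalCoeff a ε t (x, y) +
          ahi / alo * directionalCoeff a ε t (x, y) * (r - t) := by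
        gcongr
        exact ha.le_directionalCoeff ht hx hy
    _ = (1 + ahi / alo * (r - t)) * directionalCoeff a ε t (x, y) := by ring

theorem measurable_directionalCoeff (ha : IsTensor Ω ε T alo ahi a) (ht : t ∈ Icc 0 T) :
    Measurable (directionalCoeff a ε t) := by
  have hdir : ∀ i, Measurable fun z : Rn n × Rn n => direction ε z.1 z.2 i := fun i => by
    have hS : MeasurableSet {z : Rn n × Rn n | edist z.2 z.1 ≤ ε} :=
      (isClosed_le (continuous_snd.edist continuous_fst) continuous_const).measurableSet
    have hq : Measurable fun z : Rn n × Rn n => (z.2 i - z.1 i) / ‖z.2 - z.1‖ := by fun_prop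
    convert hq.indicator hS using 1
    ext z
    simp only [direction, indicator, mem_ofPred_eq]
    split_ifs <;> rfl
  rw [funext (directionalCoeff_eq_sum a ε t)]
  refine Finset.measurable_fun_sum _ fun i _ => Finset.measurable_fun_sum _ fun j _ => ?_
  have hc : Continuous fun z : Rn n × Rn n => a t z.1 z.2 i j :=
    (ha.contDiffOn i j).continuousOn.comp_continuous (f := fun z : Rn n × Rn n => (t, z.1, z.2))
      (by fun_prop) fun z => ⟨ht, mem_univ _⟩
  exact (hc.measurable.mul (hdir i)).mul (hdir j)

end IsTensor

theorem alpha_eq_smul_direction (ε : ℝ≥0∞) (β : Rn n → ℝ) (x y : Rn n) :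
    alpha ε β x y = (‖y - x‖ ^ ((n : ℝ) / 2 + β x))⁻¹ • direction ε x y := by
  unfold alpha direction
  split_ifs
  · ext i
    rcases eq_or_ne y x with rfl | hne
    · simp
    · have hpos : 0 < ‖y - x‖ := norm_pos_iff.2 (sub_ne_zero.2 hne)
      rw [Real.rpow_add_one hpos.ne', Pi.smul_apply, smul_eq_mul]
      field_simp
  · rw [smul_zero]

theorem Dstar_dotProduct_mulVec (ε : ℝ≥0∞) (β : Rn n → ℝ)
    (a : ℝ → Rn n → Rn n → Matrix (Fin n) (Fin n) ℝ) (t : ℝ) (v w : Rn n → ℝ) (x y : Rn n) :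
    Dstar ε β v x y ⬝ᵥ (a t x y *ᵥ Dstar ε β w x y) =
      directionalCoeff a ε t (x, y) * (diffQuotient β v (x, y) * diffQuotient β w (x, y)) := by
  simp only [Dstar, alpha_eq_smul_direction, Matrix.mulVec_smul, smul_dotProduct, dotProduct_smul,
    smul_eq_mul, directionalCoeff, diffQuotient]
  ring

theorem diffQuotient_sq (β v : Rn n → ℝ) (x y : Rn n) :
    diffQuotient β v (x, y) ^ 2 = (v y - v x) ^ 2 / ‖y - x‖ ^ ((n : ℝ) + 2 * β x) := by
  rw [diffQuotient, div_pow, ← Real.rpow_mul_natCast (norm_nonneg _)]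
  congr 2
  push_cast
  ring

theorem aestronglyMeasurable_diffQuotient (hβ : AEMeasurable β (volume.restrict (tildeDomain Ω ε)))
    (v : L2tilde Ω ε) : AEStronglyMeasurable (diffQuotient β v) (pairMeasure Ω ε) := by
  have hv : Measurable v := (Lp.stronglyMeasurable v).measurable
  have hnum : Measurable fun z : Rn n × Rn n => v z.2 - v z.1 := by fun_prop
  have hden : Measurable fun z : Rn n × Rn n => ‖z.2 - z.1‖ := by fun_prop
  exact (hnum.aemeasurable.div (hden.aemeasurable.pow ((hβ.comp_quasiMeasurePreserving
    Measure.quasiMeasurePreserving_fst).const_add _))).aestronglyMeasurable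

theorem diffQuotient_sub_ae_eq (β : Rn n → ℝ) (v w : L2tilde Ω ε) :
    diffQuotient β ↑(v - w) =ᵐ[pairMeasure Ω ε] diffQuotient β v - diffQuotient β w := by
  have h := Lp.coeFn_sub v w
  filter_upwards [Measure.quasiMeasurePreserving_fst.ae_eq_comp h,
    Measure.quasiMeasurePreserving_snd.ae_eq_comp h] with z h₁ h₂
  simp only [Function.comp_apply, Pi.sub_apply] at h₁ h₂
  simp only [diffQuotient, Pi.sub_apply, h₁, h₂]
  ring

theorem eLpNorm_diffQuotient (hβ : AEMeasurable β (volume.restrict (tildeDomain Ω ε)))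
    (v : L2tilde Ω ε) :
    eLpNorm (diffQuotient β v) 2 (pairMeasure Ω ε) = sobolevSemiSq Ω ε β v ^ (1 / 2 : ℝ) := by
  have hm : AEMeasurable (fun z => ‖diffQuotient β v z‖ₑ ^ 2) (pairMeasure Ω ε) :=
    (aestronglyMeasurable_diffQuotient hβ v).enorm.pow_const 2
  have henorm : ∀ x y, ‖diffQuotient β v (x, y)‖ₑ ^ 2 =
      ENNReal.ofReal ((v y - v x) ^ 2 / ‖y - x‖ ^ ((n : ℝ) + 2 * β x)) := fun x y => by
    rw [← diffQuotient_sq, ← sq_abs, ENNReal.ofReal_pow (abs_nonneg _), Real.enorm_eq_ofReal_abs]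
  rw [eLpNorm_eq_lintegral_rpow_enorm_toReal two_ne_zero ENNReal.ofNat_ne_top]
  simp only [ENNReal.toReal_ofNat, ENNReal.rpow_ofNat]
  rw [lintegral_prod _ hm]
  simp only [henorm, sobolevSemiSq]

theorem eLpNorm_diffQuotient_le_sobolevENorm
    (hβ : AEMeasurable β (volume.restrict (tildeDomain Ω ε))) (v : L2tilde Ω ε) :
    eLpNorm (diffQuotient β v) 2 (pairMeasure Ω ε) ≤ sobolevENorm Ω ε β v :=
  (eLpNorm_diffQuotient hβ v).trans_le le_add_self

theorem memLp_diffQuotient (hβ : AEMeasurable β (volume.restrict (tildeDomain Ω ε)))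
    {v : L2tilde Ω ε} (hv : sobolevENorm Ω ε β v < ⊤) :
    MemLp (diffQuotient β v) 2 (pairMeasure Ω ε) :=
  ⟨aestronglyMeasurable_diffQuotient hβ v,
    (eLpNorm_diffQuotient_le_sobolevENorm hβ v).trans_lt hv⟩

namespace IsTensor

theorem norm_directionalCoeff_le (ha : IsTensor Ω ε T alo ahi a)
    (hΩ : MeasurableSet (tildeDomain Ω ε)) (halo : 0 ≤ alo) (hahi : 0 ≤ ahi) (ht : t ∈ Icc 0 T) :
    ∀ᵐ z ∂(pairMeasure Ω ε), ‖directionalCoeff a ε t z‖ ≤ ahi :=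
  ae_pairMeasure hΩ fun _ hx _ hy =>
    (Real.norm_of_nonneg (ha.directionalCoeff_nonneg halo ht hx hy)).trans_le
      (ha.directionalCoeff_le hahi ht hx hy)

theorem energyForm_eq_integral (ha : IsTensor Ω ε T alo ahi a)
    (hΩ : MeasurableSet (tildeDomain Ω ε)) (halo : 0 ≤ alo) (hahi : 0 ≤ ahi)
    (hβ : AEMeasurable β (volume.restrict (tildeDomain Ω ε))) (ht : t ∈ Icc 0 T)
    {v w : L2tilde Ω ε} (hv : sobolevENorm Ω ε β v < ⊤) (hw : sobolevENorm Ω ε β w < ⊤) :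
    energyForm Ω ε β a t v w = ∫ z, directionalCoeff a ε t z *
      (diffQuotient β v z * diffQuotient β w z) ∂(pairMeasure Ω ε) := by
  have hintegral : Integrable (fun z => directionalCoeff a ε t z *
      (diffQuotient β v z * diffQuotient β w z)) (pairMeasure Ω ε) :=
    ((memLp_diffQuotient hβ hv).integrable_mul (memLp_diffQuotient hβ hw)).bdd_mul
      (ha.measurable_directionalCoeff ht).aestronglyMeasurable
      (ha.norm_directionalCoeff_le hΩ halo hahi ht)
  rw [integral_prod _ hintegral]
  simp only [energyForm, Dstar_dotProduct_mulVec]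

theorem energySq_lt_top (ha : IsTensor Ω ε T alo ahi a) (hΩ : MeasurableSet (tildeDomain Ω ε))
    (hahi : 0 ≤ ahi) (ht : t ∈ Icc 0 T) {v : L2tilde Ω ε} (hv : sobolevSemiSq Ω ε β v < ⊤) :
    energySq Ω ε β a t v < ⊤ := by
  have hpoint : ∀ x ∈ tildeDomain Ω ε, ∀ y ∈ tildeDomain Ω ε,
      ENNReal.ofReal (Dstar ε β v x y ⬝ᵥ (a t x y *ᵥ Dstar ε β v x y)) ≤ ENNReal.ofReal ahi *
        ENNReal.ofReal ((v y - v x) ^ 2 / ‖y - x‖ ^ ((n : ℝ) + 2 * β x)) := fun x hx y hy => by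
    rw [← ENNReal.ofReal_mul hahi, Dstar_dotProduct_mulVec, ← diffQuotient_sq, sq]
    exact ENNReal.ofReal_le_ofReal (mul_le_mul_of_nonneg_right
      (ha.directionalCoeff_le hahi ht hx hy) (mul_self_nonneg _))
  have hle : ∫⁻ x in tildeDomain Ω ε, ∫⁻ y in tildeDomain Ω ε,
      ENNReal.ofReal (Dstar ε β v x y ⬝ᵥ (a t x y *ᵥ Dstar ε β v x y)) ≤
      ENNReal.ofReal ahi * sobolevSemiSq Ω ε β v := by
    simp only [sobolevSemiSq, ← lintegral_const_mul' _ _ ENNReal.ofReal_ne_top]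
    exact setLIntegral_mono' hΩ fun x hx => setLIntegral_mono' hΩ fun y hy => hpoint x hx y hy
  exact ENNReal.mul_lt_top (by simp) (hle.trans_lt (ENNReal.mul_lt_top ENNReal.ofReal_lt_top hv))

end IsTensor

end Kernel

noncomputable section Solution

variable {n : ℕ} {bc : Constraint} {Ω : Set (Rn n)} {ε : ℝ≥0∞} {T alo ahi : ℝ} {β : Rn n → ℝ}
  {a : ℝ → Rn n → Rn n → Matrix (Fin n) (Fin n) ℝ} {u : ℝ → L2tilde Ω ε}

theorem norm_resDom_le (v : L2tilde Ω ε) : ‖resDom Ω ε v‖ ≤ ‖v‖ :=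
  norm_Lp_toLp_restrict_le Ω v

theorem norm_resDom_le_sobolevNorm {v : L2tilde Ω ε} (hv : sobolevENorm Ω ε β v < ⊤) :
    ‖resDom Ω ε v‖ ≤ sobolevNorm Ω ε β v := by
  refine (norm_resDom_le v).trans ?_
  rw [← toReal_enorm v]
  exact ENNReal.toReal_mono hv.ne le_self_add

theorem MemHc.memVc {v : L2tilde Ω ε} (hv : MemHc bc Ω ε β v) (ha : IsTensor Ω ε T alo ahi a)
    (hΩ : MeasurableSet (tildeDomain Ω ε)) (hahi : 0 ≤ ahi) : MemVc bc Ω ε β a T v :=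
  have hsemi : sobolevSemiSq Ω ε β v < ⊤ :=
    (ENNReal.rpow_lt_top_iff_of_pos one_half_pos).1 (le_add_self.trans_lt hv.1)
  ⟨fun _ ht => ha.energySq_lt_top hΩ hahi ht hsemi, hv.2⟩

theorem ContinuousInHc.continuousOn (hu : ContinuousInHc bc Ω ε β T u) :
    ContinuousOn u (Ioc 0 T) := by
  intro t ht
  rw [ContinuousWithinAt, tendsto_iff_edist_tendsto_0]
  refine tendsto_of_tendsto_of_tendsto_of_le_of_le tendsto_const_nhds (hu t ht).2
    (fun _ => zero_le) fun s => ?_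
  rw [edist_eq_enorm_sub]
  exact le_self_add

theorem ContinuousInHc.continuousOn_resDom (hu : ContinuousInHc bc Ω ε β T u) :
    ContinuousOn (fun t => resDom Ω ε (u t)) (Ioc 0 T) :=
  (resDom Ω ε).continuous.comp_continuousOn hu.continuousOn

theorem HasInitialValue.continuousOn_resDom (h₀ : HasInitialValue bc Ω ε u)
    (hu : ContinuousInHc bc Ω ε β T u) :
    ContinuousOn (fun t => resDom Ω ε (u t)) (Icc 0 T) := by
  intro t ht
  rcases ht.1.eq_or_lt with rfl | ht0
  · have hright : ContinuousWithinAt (fun t => resDom Ω ε (u t)) (Ioi 0) 0 := h₀.2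
    exact (continuousWithinAt_Ioi_iff_Ici.1 hright).mono Icc_subset_Ici_self
  · refine (hu.continuousOn_resDom t ⟨ht0, ht.2⟩).mono_of_mem_nhdsWithin ?_
    filter_upwards [self_mem_nhdsWithin, nhdsWithin_le_nhds (Ioi_mem_nhds ht0)] with s hs hs0
    exact ⟨hs0, hs.2⟩

theorem ContinuousInHc.tendsto_eLpNorm_diffQuotient (hu : ContinuousInHc bc Ω ε β T u)
    (hβ : AEMeasurable β (volume.restrict (tildeDomain Ω ε))) {t : ℝ} (ht : t ∈ Ioc 0 T) :
    Tendsto (fun r => eLpNorm (diffQuotient β (u r) - diffQuotient β (u t)) 2 (pairMeasure Ω ε))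
      (𝓝[Ioc 0 T] t) (𝓝 0) :=
  tendsto_of_tendsto_of_tendsto_of_le_of_le tendsto_const_nhds (hu t ht).2 (fun _ => zero_le)
    fun r => (eLpNorm_congr_ae (diffQuotient_sub_ae_eq β (u r) (u t))).symm.trans_le
      (eLpNorm_diffQuotient_le_sobolevENorm hβ (u r - u t))

theorem ContinuousInHc.continuousOn_energyForm (hu : ContinuousInHc bc Ω ε β T u)
    (ha : IsTensor Ω ε T alo ahi a) (hΩ : MeasurableSet (tildeDomain Ω ε)) (halo : 0 ≤ alo)
    (hahi : 0 ≤ ahi) (hβ : AEMeasurable β (volume.restrict (tildeDomain Ω ε))) :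
    ContinuousOn (Function.uncurry fun r s => energyForm Ω ε β a r (u r) (u s))
      (Ioc 0 T ×ˢ Ioc 0 T) := by
  refine ContinuousOn.congr (continuousOn_integral_mul_mul
    (k := directionalCoeff a ε) (D := fun t => diffQuotient β (u t))
    (fun t ht => (ha.measurable_directionalCoeff (Ioc_subset_Icc_self ht)).aestronglyMeasurable)
    (fun t ht => ha.norm_directionalCoeff_le hΩ halo hahi (Ioc_subset_Icc_self ht))
    (Eventually.of_forall fun z => (ha.continuousOn_directionalCoeff z).mono Ioc_subset_Icc_self)
    (fun t ht => memLp_diffQuotient hβ (hu t ht).1.1)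
    fun t ht => hu.tendsto_eLpNorm_diffQuotient hβ ht) ?_
  rintro ⟨r, s⟩ ⟨hr, hs⟩
  exact ha.energyForm_eq_integral hΩ halo hahi hβ (Ioc_subset_Icc_self hr) (hu r hr).1.1
    (hu s hs).1.1

theorem IsTensor.energyForm_self_nonneg (ha : IsTensor Ω ε T alo ahi a)
    (hΩ : MeasurableSet (tildeDomain Ω ε)) (halo : 0 ≤ alo) {t : ℝ} (ht : t ∈ Icc 0 T)
    (v : L2tilde Ω ε) : 0 ≤ energyForm Ω ε β a t v v :=
  setIntegral_nonneg hΩ fun x hx => setIntegral_nonneg hΩ fun y hy => by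
    rw [Dstar_dotProduct_mulVec]
    exact mul_nonneg (ha.directionalCoeff_nonneg halo ht hx hy) (mul_self_nonneg _)

theorem IsTensor.two_mul_energyForm_sub_le (ha : IsTensor Ω ε T alo ahi a)
    (hΩ : MeasurableSet (tildeDomain Ω ε)) (halo : 0 < alo) (hahi : 0 ≤ ahi)
    (hβ : AEMeasurable β (volume.restrict (tildeDomain Ω ε))) {t r : ℝ} (ht : t ∈ Icc 0 T)
    (hr : r ∈ Icc 0 T) (htr : t ≤ r) {v w : L2tilde Ω ε} (hv : sobolevENorm Ω ε β v < ⊤)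
    (hw : sobolevENorm Ω ε β w < ⊤) :
    2 * energyForm Ω ε β a r v w - energyForm Ω ε β a r v v ≤
      (1 + ahi / alo * (r - t)) * energyForm Ω ε β a t w w := by
  rw [ha.energyForm_eq_integral hΩ halo.le hahi hβ hr hv hw,
    ha.energyForm_eq_integral hΩ halo.le hahi hβ hr hv hv,
    ha.energyForm_eq_integral hΩ halo.le hahi hβ ht hw hw]
  exact two_mul_integral_sub_integral_le
    (ha.measurable_directionalCoeff hr).aestronglyMeasurable
    (ha.norm_directionalCoeff_le hΩ halo.le hahi hr)
    (ha.measurable_directionalCoeff ht).aestronglyMeasurable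
    (ha.norm_directionalCoeff_le hΩ halo.le hahi ht)
    (memLp_diffQuotient hβ hv) (memLp_diffQuotient hβ hw)
    (ae_pairMeasure hΩ fun x hx y hy => ha.directionalCoeff_nonneg halo.le hr hx hy)
    (ae_pairMeasure hΩ fun x hx y hy => ha.directionalCoeff_growth halo hahi ht hr htr hx hy)

namespace IsSolution

theorem isWeakTimeDeriv_inner (hsol : IsSolution bc Ω ε β a T u) {φ : L2tilde Ω ε}
    (hφ : MemVc bc Ω ε β a T φ) :
    IsWeakTimeDeriv T (fun t => (inner ℝ (resDom Ω ε (u t)) (resDom Ω ε φ) : ℝ))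
      fun t => -energyForm Ω ε β a t (u t) φ := by
  obtain ⟨u', hu', hweak, heq⟩ := hsol.equation
  have hpair := hweak.comp_clm (innerSL ℝ (resDom Ω ε φ))
    ((resDom Ω ε).integrable_comp (hsol.memLp.integrable one_le_two))
    (hu'.integrable one_le_two)
  simp only [innerSL_apply_apply, real_inner_comm _ (resDom Ω ε φ)] at hpair
  exact hpair.congr_right ((heq φ hφ).mono fun t ht => eq_neg_of_add_eq_zero_left ht)

theorem hasDerivAt_inner (hsol : IsSolution bc Ω ε β a T u) (hu : ContinuousInHc bc Ω ε β T u)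
    (ha : IsTensor Ω ε T alo ahi a) (hΩ : MeasurableSet (tildeDomain Ω ε)) (halo : 0 ≤ alo)
    (hahi : 0 ≤ ahi) (hβ : AEMeasurable β (volume.restrict (tildeDomain Ω ε))) {r s : ℝ}
    (hs : s ∈ Ioo 0 T) (hr : r ∈ Ioo 0 T) :
    HasDerivAt (fun r => inner ℝ (resDom Ω ε (u r)) (resDom Ω ε (u s)))
      (-energyForm Ω ε β a r (u r) (u s)) r := by
  have hsc : s ∈ Ioc 0 T := Ioo_subset_Ioc_self hs
  have hinner : ContinuousOn (fun r => (inner ℝ (resDom Ω ε (u r)) (resDom Ω ε (u s)) : ℝ))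
      (Ioo 0 T) := (hu.continuousOn_resDom.mono Ioo_subset_Ioc_self).inner continuousOn_const
  have henergy : ContinuousOn (fun r => energyForm Ω ε β a r (u r) (u s)) (Ioo 0 T) :=
    (hu.continuousOn_energyForm ha hΩ halo hahi hβ).comp (f := fun r => (r, s)) (by fun_prop)
      fun r hr => ⟨Ioo_subset_Ioc_self hr, hsc⟩
  exact (hsol.isWeakTimeDeriv_inner ((hu s hsc).1.memVc ha hΩ hahi)).hasDerivAt hinner
    henergy.neg hr

theorem isEnergyFlow (hsol : IsSolution bc Ω ε β a T u) (hu : ContinuousInHc bc Ω ε β T u)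
    (ha : IsTensor Ω ε T alo ahi a) (hΩ : MeasurableSet (tildeDomain Ω ε)) (halo : 0 < alo)
    (hahi : 0 ≤ ahi) (hβ : AEMeasurable β (volume.restrict (tildeDomain Ω ε))) :
    IsEnergyFlow T (ahi / alo) (fun t => resDom Ω ε (u t))
      fun r s => energyForm Ω ε β a r (u r) (u s) where
  continuousOn := (hu.continuousOn_energyForm ha hΩ halo.le hahi hβ).mono
    (prod_mono Ioo_subset_Ioc_self Ioo_subset_Ioc_self)
  hasDerivAt_inner _ hs _ hr := hsol.hasDerivAt_inner hu ha hΩ halo.le hahi hβ hs hr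
  nonneg t ht := ha.energyForm_self_nonneg hΩ halo.le (Ioo_subset_Icc_self ht) (u t)
  two_mul_sub_le t ht r hr htr := ha.two_mul_energyForm_sub_le hΩ halo hahi hβ
    (Ioo_subset_Icc_self ht) (Ioo_subset_Icc_self hr) htr (hu r (Ioo_subset_Ioc_self hr)).1.1
    (hu t (Ioo_subset_Ioc_self ht)).1.1

theorem integrableOn_norm_sq (hsol : IsSolution bc Ω ε β a T u) :
    IntegrableOn (fun t => ‖resDom Ω ε (u t)‖ ^ 2) (Ioo 0 T) :=
  ((resDom Ω ε).comp_memLp' hsol.memLp).integrable_norm_pow two_ne_zero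

theorem timeL2Norm_resDom_le (hsol : IsSolution bc Ω ε β a T u) :
    timeL2Norm T (fun t => resDom Ω ε (u t)) ≤ timeL2Norm T u := by
  refine Real.sqrt_le_sqrt (integral_mono hsol.integrableOn_norm_sq
    (hsol.memLp.integrable_norm_pow two_ne_zero) fun t => ?_)
  exact pow_le_pow_left₀ (norm_nonneg _) (norm_resDom_le (u t)) 2

theorem norm_resDom_le_interpolation (hsol : IsSolution bc Ω ε β a T u)
    (hu : ContinuousInHc bc Ω ε β T u) (ha : IsTensor Ω ε T alo ahi a)
    (hΩ : MeasurableSet (tildeDomain Ω ε)) (halo : 0 < alo) (hahi : 0 < ahi)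
    (hβ : AEMeasurable β (volume.restrict (tildeDomain Ω ε))) {t₁ t : ℝ} (ht₁ : 0 < t₁)
    (ht : t ∈ Ioo t₁ T) :
    ‖resDom Ω ε (u t)‖ ≤ 1 / √t₁ ^ (1 - expWeight (ahi / alo) t₁ T t) *
      timeL2Norm T u ^ (1 - expWeight (ahi / alo) t₁ T t) *
        sobolevNorm Ω ε β (u T) ^ expWeight (ahi / alo) t₁ T t := by
  have hκ : 0 < ahi / alo := div_pos hahi halo
  obtain ⟨hθ0, hθ1⟩ := expWeight_mem_Ioo hκ ht
  have hT : T ∈ Ioc 0 T := ⟨ht₁.trans (ht.1.trans ht.2), le_rfl⟩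
  have hU : 0 ≤ timeL2Norm T fun t => resDom Ω ε (u t) := timeL2Norm_nonneg _ _
  have hu0 : 0 ≤ timeL2Norm T u := timeL2Norm_nonneg T u
  refine ((hsol.isEnergyFlow hu ha hΩ halo hahi.le hβ).norm_le_timeL2Norm_rpow_mul_rpow hκ
    hu.continuousOn_resDom hsol.integrableOn_norm_sq ht₁ ht).trans ?_
  gcongr
  · exact hsol.timeL2Norm_resDom_le
  · exact norm_resDom_le_sobolevNorm (hu T hT).1.1

theorem timeL2Norm_le_log (hsol : IsSolution bc Ω ε β a T u)
    (hu : ContinuousInHc bc Ω ε β T u) (h₀ : HasInitialValue bc Ω ε u)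
    (ha : IsTensor Ω ε T alo ahi a) (hΩ : MeasurableSet (tildeDomain Ω ε)) (hT : 0 < T)
    (halo : 0 < alo) (hahi : 0 < ahi) (hβ : AEMeasurable β (volume.restrict (tildeDomain Ω ε)))
    (hS : 0 < sobolevNorm Ω ε β (u T)) (hS1 : sobolevNorm Ω ε β (u T) < 1) :
    timeL2Norm T (fun t => resDom Ω ε (u t)) ≤
      (2 * (ahi / alo / (Real.exp (ahi / alo * T) - 1))) ^ (-(1 / 2) : ℝ) * (1 + ‖u 0‖) *
        Real.log (1 / sobolevNorm Ω ε β (u T)) ^ (-(1 / 2) : ℝ) :=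
  (hsol.isEnergyFlow hu ha hΩ halo hahi.le hβ).timeL2Norm_le (div_pos hahi halo) hT
    (h₀.continuousOn_resDom hu) (le_add_of_nonneg_right (norm_nonneg _))
    ((norm_resDom_le (u 0)).trans (le_add_of_nonneg_left zero_le_one)) hS hS1
    (norm_resDom_le_sobolevNorm (hu T ⟨hT, le_rfl⟩).1.1)

end IsSolution

end Solution

end NonlocalDiffusion

theorem theorem4p1_general {n : ℕ} (bc : Constraint) (Ω : Set (Rn n)) (ε : ℝ≥0∞)
    (hΩ : MeasurableSet (tildeDomain Ω ε)) (T : ℝ) (hT : 0 < T)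
    (alo ahi : ℝ) (halo : 0 < alo) (hahi : 0 < ahi) :
    (∀ t₀ ∈ Ioo 0 T, ∃ θ ∈ Ioo (0 : ℝ) 1, ∃ C > 0,
      ∀ (β : Rn n → ℝ) (a : ℝ → Rn n → Rn n → Matrix (Fin n) (Fin n) ℝ) (u : ℝ → L2tilde Ω ε),
        AEMeasurable β (volume.restrict (tildeDomain Ω ε)) → IsTensor Ω ε T alo ahi a →
        IsSolution bc Ω ε β a T u → ContinuousInHc bc Ω ε β T u →
        ‖resDom Ω ε (u t₀)‖ ≤
          C * timeL2Norm T u ^ (1 - θ) * sobolevNorm Ω ε β (u T) ^ θ) ∧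
    (∃ C > 0,
      ∀ (β : Rn n → ℝ) (a : ℝ → Rn n → Rn n → Matrix (Fin n) (Fin n) ℝ) (u : ℝ → L2tilde Ω ε),
        AEMeasurable β (volume.restrict (tildeDomain Ω ε)) → IsTensor Ω ε T alo ahi a →
        IsSolution bc Ω ε β a T u → ContinuousInHc bc Ω ε β T u →
        HasInitialValue bc Ω ε u →
        0 < sobolevNorm Ω ε β (u T) → sobolevNorm Ω ε β (u T) < 1 →
        timeL2Norm T (fun t => resDom Ω ε (u t)) ≤
          C * (1 + ‖u 0‖) * Real.log (1 / sobolevNorm Ω ε β (u T)) ^ (-(1 / 2) : ℝ)) := by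
  have hκ : 0 < ahi / alo := div_pos hahi halo
  refine ⟨fun t₀ ht₀ => ?_, ?_⟩
  · have ht₁ : 0 < t₀ / 2 := half_pos ht₀.1
    have ht : t₀ ∈ Ioo (t₀ / 2) T := ⟨half_lt_self ht₀.1, ht₀.2⟩
    exact ⟨_, expWeight_mem_Ioo hκ ht, _,
      one_div_pos.2 (Real.rpow_pos_of_pos (Real.sqrt_pos.2 ht₁) _), fun β a u hβ ha hsol hu =>
        hsol.norm_resDom_le_interpolation hu ha hΩ halo hahi hβ ht₁ ht⟩
  · have hexp : 0 < Real.exp (ahi / alo * T) - 1 :=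
      sub_pos.2 (Real.one_lt_exp_iff.2 (mul_pos hκ hT))
    exact ⟨_, Real.rpow_pos_of_pos (mul_pos two_pos (div_pos hκ hexp)) _,
      fun β a u hβ ha hsol hu h₀ hS hS1 =>
        hsol.timeL2Norm_le_log hu h₀ ha hΩ hT halo hahi hβ hS hS1⟩

theorem theorem4p1 {n : ℕ} (bc : Constraint) (Ω : Set (Rn n)) (hΩ : IsOpen Ω)
    (hΩb : Bornology.IsBounded Ω) (ε : ℝ≥0∞) (hε : 0 < ε) (T : ℝ) (hT : 0 < T)
    (alo ahi : ℝ) (halo : 0 < alo) (hahi : alo ≤ ahi) :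
    (∀ t₀ ∈ Ioo 0 T, ∃ θ ∈ Ioo (0 : ℝ) 1, ∃ C > 0,
      ∀ (β : Rn n → ℝ) (a : ℝ → Rn n → Rn n → Matrix (Fin n) (Fin n) ℝ) (u : ℝ → L2tilde Ω ε),
        IsOrder Ω ε β → IsTensor Ω ε T alo ahi a →
        IsSolution bc Ω ε β a T u → ContinuousInHc bc Ω ε β T u →
        ‖resDom Ω ε (u t₀)‖ ≤
          C * timeL2Norm T u ^ (1 - θ) * sobolevNorm Ω ε β (u T) ^ θ) ∧
    (∃ C > 0,
      ∀ (β : Rn n → ℝ) (a : ℝ → Rn n → Rn n → Matrix (Fin n) (Fin n) ℝ) (u : ℝ → L2tilde Ω ε),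
        IsOrder Ω ε β → IsTensor Ω ε T alo ahi a →
        IsSolution bc Ω ε β a T u → ContinuousInHc bc Ω ε β T u →
        HasInitialValue bc Ω ε u →
        0 < sobolevNorm Ω ε β (u T) → sobolevNorm Ω ε β (u T) < 1 →
        timeL2Norm T (fun t => resDom Ω ε (u t)) ≤
          C * (1 + ‖u 0‖) * Real.log (1 / sobolevNorm Ω ε β (u T)) ^ (-(1 / 2) : ℝ)) := by
  have hmeas : MeasurableSet (tildeDomain Ω ε) := (isOpen_tildeDomain hΩ ε).measurableSet
  obtain ⟨hinterp, C, hC, hlog⟩ :=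
    theorem4p1_general bc Ω ε hmeas T hT alo ahi halo (halo.trans_le hahi)
  refine ⟨fun t₀ ht₀ => ?_, C, hC, fun β a u hβ => hlog β a u (hβ.1.aemeasurable hmeas)⟩
  obtain ⟨θ, hθ, C, hC, hbound⟩ := hinterp t₀ ht₀
  exact ⟨θ, hθ, C, hC, fun β a u hβ => hbound β a u (hβ.1.aemeasurable hmeas)⟩
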